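/- **Setting.** Let $D\ge 0$ and $M\ge 1$ be integers, let $\mathbb P_1,\dots,\mathbb P_M$ be probability measures on $[0,1]^D$ with supports $S_i=\operatorname{supp}(\mathbb P_i)$, let $S_0=[0,1]^D\setminus\bigcup_{i\ge1} S_i$, and let $\mathbb P_0$ be a probability measure with $\operatorname{supp}(\mathbb P_0)\subseteq\overline{S_0}$ and $\mathbb P_0(\overline{S_0}\cap S_i)=0$ for $1\le i\le M$. Let $\gamma_1,\dots,\gamma_M\ge0$ with $\sum_i\gamma_i=1$. For every $n$ let $\varepsilon_n$ be a real number and let $X_1,\dots,X_n$ be independent with common law $\varepsilon_n\mathbb P_0+(1-\varepsilon_n)\sum_{i=1}^M\gamma_i\mathbb P_i$; everything except $\varepsilon_n$ is fixed. Let $\mathcal H^s$ be the $s$-dimensional Hausdorff measure, normalised so that $\mathcal H^D$ is Lebesgue measure, $\eta(s)=\pi^{s/2}/\Gamma(1+s/2)$, $s_i=\dim_H S_i$, $d=\max_i s_i$, $\gamma_*=\min_i\gamma_i$, $\gamma^*=\max_i\gamma_i$ and $\bar\gamma=\gamma_*-\gamma^*/2$. Assume: - (A1) every $S_i$ ($1\le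 i\le M$) is connected, and there is $\delta>0$ with $\|x-y\|\ge\delta$ for all $x\in S_i$, $y\in S_j$, $1\le i\neq j\le M$; - (A2) $\kappa_0>0$ and $\mathbb P_0(A)\le\kappa_0\mathcal H^D(A)$ for all Borel $A\subseteq S_0$; - (A3) for $1\le i\le M$, $\kappa_i>0$ and $\mathbb P_i(A)\ge\kappa_i^{-1}\mathcal H^{s_i}(A)$ for all Borel $A\subseteq S_i$; - (A4) $\kappa_c\ge1$ and $\kappa_c^{-1}\eta(s_i)r^{s_i}\le\mathcal H^{s_i}(S_i\cap B(x,r))\le\kappa_c\,\eta(s_i)r^{s_i}$ for $1\le i\le M$, $x\in S_i$ and $0<r\le\operatorname{diam}(S_i)$, where $B(x,r)$ is the open Euclidean ball; - (A5) for $1\le i\le M$, $s_i=\lim_{r\to0}\log N_r(S_i)/\log(1/r)$, where $N_r(S_i)$ is the minimal number of open balls of radius $r$ covering $S_i$; - (A6) $\gamma^*<2\gamma_*$ and $0\le\varepsilon_n<\bar\gamma/(1+\bar\gamma)$ for all $n$. Put $\mathfrak a=\dfrac{\gamma_*\,(\kappa_c\max_i\kappa_i)^{-1}\min(1,\eta(d))}{1+\bar\gamma}$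 and $\mathfrak b=\eta(D)\kappa_0$. **OSL procedure.** For $r\ge0$, the single linkage clusters at radius $r$ are the classes of observations that lie in the same connected component of the union of the closed balls of radius $r/2$ around $X_1,\dots,X_n$ (observations are counted with multiplicity). Order them by decreasing size, ties being broken in favour of the smallest index of an observation, and let $\mathcal X_1(r),\dots,\mathcal X_M(r)$ be the first $M$ of them, with $\mathcal X_m(r)=\emptyset$ if there are fewer than $m$ clusters. Let $\rho_0=0$ and, as long as there are at least two clusters at radius $\rho_k$, let $\rho_{k+1}$ be the smallest distance between two observations in different clusters at radius $\rho_k$. Let $\widehat r_n$ be the largest of the radii $\rho_k$ that maximise $|\mathcal X_M(\rho_k)|$ over all $k$. The clustering risk is $$\mathcal R_n(\mathcal X(\widehat r_n))=\mathbb P\bigl(\forall\,\pi\in\Pi_M\ \exists\, i\in\{1,\dots,M\}:\ \{X_1,\dots,X_n\}\cap S_i\not\subseteq\mathcal X_{\pi(i)}(\widehat r_n)\bigr),$$ where $\Pi_M$ is the set of permutations of $\{1,\dots,M\}$. **Statement.** For every $D$ there is a constant $c_D>0$, depending only on $D$, such that in every setting as above the OSL procedure is consistent, i.e. $$\lim_{n\to\infty}\mathcal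 R_n(\mathcal X(\widehat r_n))=0,$$ as soon as either $d<D$, or $d=D$ and $\varepsilon_n<c_D\,\mathfrak a\,(\mathfrak b\log n)^{-1}$ for all sufficiently large $n$. (In particular, when $d=D$, it is consistent whenever $\varepsilon_n$ tends to $0$ faster than $1/\log n$, that is, $\varepsilon_n\log n\to0$.) -/

import Mathlib

open MeasureTheory Filter Topology
open scoped ENNReal

noncomputable section

namespace OSL

/-- The Euclidean space `ℝ^D`. -/
abbrev E (D : ℕ) : Type := EuclideanSpace ℝ (Fin D)

/-- The unit cube `[0,1]^D`. -/
def cube (D : ℕ) : Set (E D) := {x | ∀ j, x j ∈ Set.Icc (0 : ℝ) 1}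

/-- `η(s) = π^{s/2} / Γ(1 + s/2)`, the volume of the unit ball in dimension `s`. -/
def ballVol (s : ℝ) : ℝ := Real.pi ^ (s / 2) / Real.Gamma (1 + s / 2)

/-- The `s`-dimensional Hausdorff outer measure, in the classical normalisation for which it is
Lebesgue measure when `s` is the dimension of the ambient space. (Mathlib's `μH[s]` sums
`diam ^ s` without the factor `η(s) / 2 ^ s`.) -/
def hausdorff {D : ℕ} (s : ℝ) (A : Set (E D)) : ℝ≥0∞ :=
  ENNReal.ofReal (ballVol s / 2 ^ s) * Measure.hausdorffMeasure s A

/-! ### The generative model -/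

section Model

variable {D M : ℕ}

/-- The mixture `ε P₀ + (1 - ε) ∑ γᵢ Pᵢ`. -/
def mixture (P₀ : Measure (E D)) (P : Fin M → Measure (E D)) (γ : Fin M → ℝ) (ε : ℝ) :
    Measure (E D) :=
  ENNReal.ofReal ε • P₀ + ENNReal.ofReal (1 - ε) • ∑ i, ENNReal.ofReal (γ i) • P i

/-- `S i = supp (P i)`. -/
def S (P : Fin M → Measure (E D)) (i : Fin M) : Set (E D) := (P i).support

/-- `S₀ = [0,1]^D \ ⋃ i, S i`, the region of the outliers. -/
def outlierSet (P : Fin M → Measure (E D)) : Set (E D) := cube D \ ⋃ i, S P i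

/-- `s i`, the Hausdorff dimension of `S i` (at most `D`, hence finite). -/
def sdim (P : Fin M → Measure (E D)) (i : Fin M) : ℝ := (dimH (S P i)).toReal

/-- `d = max s i`. -/
def maxDim (P : Fin M → Measure (E D)) : ℝ := ⨆ i, sdim P i

/-- The standing requirements of the generative model: `P₀, P₁, …, P_M` are probability
distributions, `P₁, …, P_M` live on the cube, `γ` is a vector of convex weights, and the outlier
distribution `P₀` is carried by the closure of `S₀` and does not charge the supports `S i`. -/
structure IsModel (P₀ : Measure (E D)) (P : Fin M → Measure (E D)) (γ : Fin M → ℝ) : Prop where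
  prob_outlier : IsProbabilityMeasure P₀
  prob : ∀ i, IsProbabilityMeasure (P i)
  cube_compl : ∀ i, P i (cube D)ᶜ = 0
  weight_nonneg : ∀ i, 0 ≤ γ i
  weight_sum : ∑ i, γ i = 1
  support_outlier : P₀.support ⊆ closure (outlierSet P)
  outlier_null : ∀ i, P₀ (closure (outlierSet P) ∩ S P i) = 0

/-! ### Assumptions (A1)-(A6) -/

/-- The supports are connected, and at positive distance from one another. -/
def A1 (P : Fin M → Measure (E D)) : Prop :=
  (∀ i, IsConnected (S P i)) ∧
    ∃ δ : ℝ, 0 < δ ∧ ∀ i j, i ≠ j → ∀ x ∈ S P i, ∀ y ∈ S P j, δ ≤ dist x y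

/-- On `S₀` the outlier distribution is bounded by `κ₀ ℋ^D`. -/
def A2 (P₀ : Measure (E D)) (P : Fin M → Measure (E D)) (κ₀ : ℝ) : Prop :=
  0 < κ₀ ∧ ∀ A : Set (E D), MeasurableSet A → A ⊆ outlierSet P →
    P₀ A ≤ ENNReal.ofReal κ₀ * hausdorff (D : ℝ) A

/-- On `S i` the distribution `P i` is at least `κᵢ⁻¹ ℋ^{sᵢ}`. -/
def A3 (P : Fin M → Measure (E D)) (κ : Fin M → ℝ) : Prop :=
  ∀ i, 0 < κ i ∧ ∀ A : Set (E D), MeasurableSet A → A ⊆ S P i →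
    ENNReal.ofReal (κ i)⁻¹ * hausdorff (sdim P i) A ≤ P i A

/-- Up to the factor `κc`, the set `S i` has in small balls centred on it the `ℋ^{sᵢ}`-measure of
a ball of dimension `sᵢ`. -/
def A4 (P : Fin M → Measure (E D)) (κc : ℝ) : Prop :=
  1 ≤ κc ∧ ∀ i, ∀ x ∈ S P i, ∀ r : ℝ, 0 < r → r ≤ Metric.diam (S P i) →
    ENNReal.ofReal (κc⁻¹ * (ballVol (sdim P i) * r ^ sdim P i)) ≤
        hausdorff (sdim P i) (S P i ∩ Metric.ball x r) ∧
      hausdorff (sdim P i) (S P i ∩ Metric.ball x r) ≤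
        ENNReal.ofReal (κc * (ballVol (sdim P i) * r ^ sdim P i))

/-- The minimal number of open balls of radius `r` required to cover `A`. -/
def coverNum (A : Set (E D)) (r : ℝ) : ℕ :=
  sInf {k : ℕ | ∃ C : Finset (E D), C.card = k ∧ A ⊆ ⋃ c ∈ C, Metric.ball c r}

/-- The Hausdorff dimension of `S i` agrees with its Minkowski-Bouligand dimension. -/
def A5 (P : Fin M → Measure (E D)) : Prop :=
  ∀ i, Tendsto (fun r : ℝ => Real.log (coverNum (S P i) r) / Real.log (1 / r)) (𝓝[>] 0)
    (𝓝 (sdim P i))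

/-- `γ_* = min γ i`. -/
def gammaMin (γ : Fin M → ℝ) : ℝ := ⨅ i, γ i

/-- `γ^* = max γ i`. -/
def gammaMax (γ : Fin M → ℝ) : ℝ := ⨆ i, γ i

/-- `γ_* - γ^* / 2`. -/
def gammaBar (γ : Fin M → ℝ) : ℝ := gammaMin γ - gammaMax γ / 2

/-- The group weights are of the same order and the proportion of outliers is small enough. -/
def A6 (γ : Fin M → ℝ) (ε : ℝ) : Prop :=
  gammaMax γ < 2 * gammaMin γ ∧ 0 ≤ ε ∧ ε < gammaBar γ / (1 + gammaBar γ)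

/-- `𝔞 = γ_* (κ^* κc)⁻¹ η_*(d) / (1 + γbar)`, with `κ^* = max κ i` and
`η_*(d) = min (1, η(d))`. -/
def constA (P : Fin M → Measure (E D)) (γ κ : Fin M → ℝ) (κc : ℝ) : ℝ :=
  gammaMin γ * ((⨆ i, κ i) * κc)⁻¹ * min 1 (ballVol (maxDim P)) / (1 + gammaBar γ)

/-- `𝔟 = η(D) κ₀`. -/
def constB (D : ℕ) (κ₀ : ℝ) : ℝ := ballVol D * κ₀

end Model

/-! ### The single linkage clusters and the OSL procedure

Clusters are sets of observations, i.e. of indices `k : Fin n`, so that coinciding observations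
are counted with multiplicity. -/

section Procedure

variable {D n : ℕ}

/-- `B(𝕏ₙ, r/2)`, the union of the closed balls of radius `r/2` around the observations. -/
def thickening (X : Fin n → E D) (r : ℝ) : Set (E D) := ⋃ k, Metric.closedBall (X k) (r / 2)

open Classical in
/-- The single linkage cluster of the `k`-th observation at radius `r`: the observations in the
connected component of `B(𝕏ₙ, r/2)` that contains `X k`. -/
def cluster (X : Fin n → E D) (r : ℝ) (k : Fin n) : Finset (Fin n) :=
  Finset.univ.filter fun l => X l ∈ connectedComponentIn (thickening X r) (X k)

/-- The family `𝒴(r)` of all single linkage clusters at radius `r`. -/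
def clusters (X : Fin n → E D) (r : ℝ) : Finset (Finset (Fin n)) :=
  Finset.univ.image (cluster X r)

/-- `A` is declared bigger than `B`: it has more elements, or equally many and a smaller
smallest index. -/
def Bigger (A B : Finset (Fin n)) : Prop :=
  B.card < A.card ∨ (A.card = B.card ∧ A.min < B.min)

open Classical in
/-- The rank of a cluster in `𝒴(r)` by decreasing size: the number of clusters that are bigger,
so that the largest cluster has rank `0`. -/
def rank (X : Fin n → E D) (r : ℝ) (B : Finset (Fin n)) : ℕ :=
  ((clusters X r).filter fun A => Bigger A B).card

/-- The cluster of rank `m` at radius `r`, empty if there are at most `m` clusters. The clusters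
`𝒳₁(r), …, 𝒳_M(r)` are those of rank `0, …, M - 1`. -/
def largest (X : Fin n → E D) (r : ℝ) (m : ℕ) : Finset (Fin n) :=
  Finset.univ.filter fun k => rank X r (cluster X r k) = m

/-- The radii `ρ₀ = 0 < ρ₁ < ρ₂ < …` of the single linkage process: as long as there are at least
two clusters, the radius that follows `ρ` is the smallest distance between observations in
different clusters at radius `ρ`, that is, the distance of the two closest clusters. -/
inductive IsRadius (X : Fin n → E D) : ℝ → Prop
  | zero : IsRadius X 0
  | next (ρ t : ℝ) : IsRadius X ρ →
      IsLeast {u | ∃ k l, cluster X ρ k ≠ cluster X ρ l ∧ u = dist (X k) (X l)} t → IsRadius X t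

/-- The selected radius `r̂ₙ`: the largest among the radii `ρ` of the process that maximise the
size of the `M`-th largest cluster `𝒳_M(ρ)`. -/
def selectedRadius (M : ℕ) (X : Fin n → E D) : ℝ :=
  sSup {ρ | IsRadius X ρ ∧ ∀ ρ', IsRadius X ρ' →
    (largest X ρ' (M - 1)).card ≤ (largest X ρ (M - 1)).card}

end Procedure

/-- The clustering risk `ℛₙ(𝒳(r̂ₙ))` for `n` independent observations with common law `Q`: the
probability that for every permutation `π` some `𝕏ₙ ∩ S i` is not contained in
`𝒳_{π(i)}(r̂ₙ)`. -/
def risk {D M : ℕ} (P : Fin M → Measure (E D)) (Q : Measure (E D)) (n : ℕ) : ℝ≥0∞ :=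
  Measure.pi (fun _ : Fin n => Q)
    {X | ∀ π : Equiv.Perm (Fin M), ∃ i : Fin M,
      ¬ ∀ k, X k ∈ S P i → k ∈ largest X (selectedRadius M X) (π i)}

end OSL

end

/-!
The selected radius is controlled by a deterministic criterion,
`OSL.exists_perm_subset_largest`. Suppose that at some radius `r` the observations of each support
`S i` lie in one cluster, those of distinct supports lie in distinct clusters, every group has more
observations than there are outliers, and no cluster at `r` is large enough to hold two groups of
minimal size. Below `r`, if the `M`-th largest cluster is larger than at `r`, the `M` largest
clusters sit inside distinct clusters at `r`, so that the criterion `|𝒳_M|` cannot exceed its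
value at `r`. Hence the selected radius is at least the last radius of the process
before `r`. Each of the `M` largest clusters at the selected radius is too large to consist of
outliers only, so it contains a whole group, and the groups are matched to the `M` largest clusters.

It remains to find a radius `r = 4 ρ` with these properties with probability tending to `1`
(`OSL.risk_le`).

* By `A3` and `A4` a ball of radius `ρ` around a point of `S i` has mass at least a multiple of
  `𝔞 ρ ^ d`, and `S i` is covered by a multiple of `ρ ^ (-D)` such balls. When none of them is empty,
  the balls of radius `r / 2` around the observations cover the connected set `S i`.
* If two supports are linked at radius `r`, there is a chain of distinct outliers with steps of
  length at most `r` whose length is of the order `δ / r` (`OSL.exists_outlier_chain`). By `A2` each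
  step multiplies the expected number of chains by `n ε 𝔟 r ^ D`, up to a constant
  (`OSL.pi_exists_chain_le`). If this factor is at most `e⁻¹`, chains with more than `2 log n` steps
  have vanishing probability.
* The group sizes concentrate by Chebyshev's inequality, and `A6` gives a margin for the required
  inequalities that is uniform in `n`.

For `d < D` the scale `ρ = n ^ (-β)` with `β d < 1 < β D` fills the supports and makes the factor
of a chain tend to `0`. For `d = D` the scale with `𝔞 n ρ ^ D` proportional to `log n` fills them, and
the factor of a chain is then of the order `ε 𝔟 log n / 𝔞`, which the hypothesis on `ε` makes small.
Only the dependence of the constants on `D` matters, so the Hausdorff measure of balls enters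
through translation invariance and homogeneity, and `η` through a positive lower bound on
`[0, D]`.
-/

namespace OSL

/-! ### Single linkage clusters as components of a proximity graph -/

section Clusters

variable {D n : ℕ}

/-- The graph on the observations that joins two of them when they are at distance at most `r`. -/
def proxGraph (X : Fin n → E D) (r : ℝ) : SimpleGraph (Fin n) where
  Adj k l := k ≠ l ∧ dist (X k) (X l) ≤ r
  symm := ⟨fun k l h => ⟨h.1.symm, by rw [dist_comm]; exact h.2⟩⟩
  loopless := ⟨fun _ h => h.1 rfl⟩

lemma proxGraph_mono (X : Fin n → E D) {r t : ℝ} (h : r ≤ t) : proxGraph X r ≤ proxGraph X t :=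
  fun _ _ hkl => ⟨hkl.1, hkl.2.trans h⟩

lemma reachable_of_dist_le {X : Fin n → E D} {r : ℝ} {k l : Fin n} (h : dist (X k) (X l) ≤ r) :
    (proxGraph X r).Reachable k l := by
  by_cases hkl : k = l
  · rw [hkl]
  · exact SimpleGraph.Adj.reachable ⟨hkl, h⟩

lemma mem_thickening (X : Fin n → E D) {r : ℝ} (hr : 0 ≤ r) (k : Fin n) :
    X k ∈ thickening X r :=
  Set.mem_iUnion.2 ⟨k, Metric.mem_closedBall_self (by linarith)⟩

lemma mem_cluster {X : Fin n → E D} {r : ℝ} {k l : Fin n} :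
    l ∈ cluster X r k ↔ X l ∈ connectedComponentIn (thickening X r) (X k) := by
  simp [cluster]

/-- The balls around the observations in one graph component and those around the remaining
observations form two disjoint closed sets, so a connected set cannot meet both. -/
lemma mem_cluster_iff_reachable {X : Fin n → E D} {r : ℝ} (hr : 0 ≤ r) {k l : Fin n} :
    l ∈ cluster X r k ↔ (proxGraph X r).Reachable k l := by
  rw [mem_cluster]
  constructor
  · intro h
    by_contra hkl
    set u : Set (E D) := ⋃ a : {a // (proxGraph X r).Reachable k a},
      Metric.closedBall (X a) (r / 2)
    set v : Set (E D) := ⋃ a : {a // ¬ (proxGraph X r).Reachable k a},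
      Metric.closedBall (X a) (r / 2)
    have hu : IsClosed u := isClosed_iUnion_of_finite fun _ => Metric.isClosed_closedBall
    have hv : IsClosed v := isClosed_iUnion_of_finite fun _ => Metric.isClosed_closedBall
    have huv : thickening X r ⊆ u ∪ v := by
      intro x hx
      obtain ⟨a, ha⟩ := Set.mem_iUnion.1 hx
      by_cases hka : (proxGraph X r).Reachable k a
      · exact Or.inl (Set.mem_iUnion.2 ⟨⟨a, hka⟩, ha⟩)
      · exact Or.inr (Set.mem_iUnion.2 ⟨⟨a, hka⟩, ha⟩)
    have hpre : IsPreconnected (connectedComponentIn (thickening X r) (X k)) :=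
      isPreconnected_connectedComponentIn
    obtain ⟨x, -, hxu, hxv⟩ := isPreconnected_closed_iff.1 hpre u v hu hv
      ((connectedComponentIn_subset _ _).trans huv)
      ⟨X k, mem_connectedComponentIn (mem_thickening X hr k),
        Set.mem_iUnion.2 ⟨⟨k, SimpleGraph.Reachable.refl _⟩,
          Metric.mem_closedBall_self (by linarith)⟩⟩
      ⟨X l, h, Set.mem_iUnion.2 ⟨⟨l, hkl⟩, Metric.mem_closedBall_self (by linarith)⟩⟩
    obtain ⟨⟨a, ha⟩, hxa⟩ := Set.mem_iUnion.1 hxu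
    obtain ⟨⟨b, hb⟩, hxb⟩ := Set.mem_iUnion.1 hxv
    refine hb (ha.trans (reachable_of_dist_le ?_))
    have h1 : dist x (X a) ≤ r / 2 := hxa
    have h2 : dist x (X b) ≤ r / 2 := hxb
    have h3 := dist_triangle_left (X a) (X b) x
    linarith
  · intro h
    obtain ⟨w⟩ := h
    induction w with
    | nil => exact mem_connectedComponentIn (mem_thickening X hr _)
    | @cons a b c hab w ih =>
      have hmem : X b ∈ connectedComponentIn (thickening X r) (X a) := by
        have hd : dist (X a) (X b) ≤ r := hab.2
        -- two balls of radius `r / 2` whose centres are at distance at most `r` share the midpoint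
        have hmid : (midpoint ℝ (X a) (X b)) ∈
            Metric.closedBall (X a) (r / 2) ∩ Metric.closedBall (X b) (r / 2) := by
          constructor
          · rw [Metric.mem_closedBall, dist_midpoint_left, Real.norm_ofNat]; linarith
          · rw [Metric.mem_closedBall, dist_midpoint_right, Real.norm_ofNat]; linarith
        have hc : IsPreconnected
            (Metric.closedBall (X a) (r / 2) ∪ Metric.closedBall (X b) (r / 2)) :=
          IsPreconnected.union _ hmid.1 hmid.2 (convex_closedBall _ _).isPreconnected
            (convex_closedBall _ _).isPreconnected
        refine hc.subset_connectedComponentIn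
          (Or.inl (Metric.mem_closedBall_self (by linarith))) ?_
          (Or.inr (Metric.mem_closedBall_self (by linarith)))
        exact Set.union_subset (Set.subset_iUnion_of_subset a subset_rfl)
          (Set.subset_iUnion_of_subset b subset_rfl)
      rwa [connectedComponentIn_eq hmem]

lemma self_mem_cluster {X : Fin n → E D} {r : ℝ} (hr : 0 ≤ r) (k : Fin n) :
    k ∈ cluster X r k :=
  (mem_cluster_iff_reachable hr).2 (SimpleGraph.Reachable.refl _)

lemma cluster_eq_iff {X : Fin n → E D} {r : ℝ} (hr : 0 ≤ r) {k l : Fin n} :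
    cluster X r k = cluster X r l ↔ (proxGraph X r).Reachable k l := by
  constructor
  · intro h
    rw [← mem_cluster_iff_reachable hr, h]
    exact self_mem_cluster hr l
  · intro h
    ext a
    rw [mem_cluster_iff_reachable hr, mem_cluster_iff_reachable hr]
    exact ⟨fun ha => h.symm.trans ha, fun ha => h.trans ha⟩

lemma cluster_eq_of_mem {X : Fin n → E D} {r : ℝ} (hr : 0 ≤ r) {k l : Fin n}
    (h : l ∈ cluster X r k) : cluster X r l = cluster X r k :=
  ((cluster_eq_iff hr).2 ((mem_cluster_iff_reachable hr).1 h)).symm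

lemma cluster_mono {X : Fin n → E D} {r t : ℝ} (hr : 0 ≤ r) (h : r ≤ t) (k : Fin n) :
    cluster X r k ⊆ cluster X t k := by
  intro l hl
  rw [mem_cluster_iff_reachable (hr.trans h)]
  exact ((mem_cluster_iff_reachable hr).1 hl).mono (proxGraph_mono X h)

lemma mem_clusters {X : Fin n → E D} {r : ℝ} {A : Finset (Fin n)} :
    A ∈ clusters X r ↔ ∃ k, cluster X r k = A := by
  simp [clusters]

lemma cluster_mem_clusters (X : Fin n → E D) (r : ℝ) (k : Fin n) :
    cluster X r k ∈ clusters X r := mem_clusters.2 ⟨k, rfl⟩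

lemma eq_cluster_of_mem {X : Fin n → E D} {r : ℝ} (hr : 0 ≤ r) {A : Finset (Fin n)}
    (hA : A ∈ clusters X r) {k : Fin n} (hk : k ∈ A) : A = cluster X r k := by
  obtain ⟨l, rfl⟩ := mem_clusters.1 hA
  exact (cluster_eq_of_mem hr hk).symm

/-! ### Ranking the clusters by size -/

lemma Bigger.trans {A B C : Finset (Fin n)} (h : Bigger A B) (h' : Bigger B C) :
    Bigger A C := by
  rcases h with h | ⟨h, hm⟩ <;> rcases h' with h' | ⟨h', hm'⟩
  · exact Or.inl (h'.trans h)
  · exact Or.inl (h' ▸ h)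
  · exact Or.inl (h ▸ h')
  · exact Or.inr ⟨h.trans h', hm.trans hm'⟩

lemma not_bigger_self (A : Finset (Fin n)) : ¬ Bigger A A := by
  rintro (h | ⟨-, h⟩)
  · exact lt_irrefl _ h
  · exact lt_irrefl _ h

/-- Distinct clusters are disjoint and non-empty, hence have distinct smallest indices. -/
lemma bigger_or_bigger {X : Fin n → E D} {r : ℝ} (hr : 0 ≤ r) {A B : Finset (Fin n)}
    (hA : A ∈ clusters X r) (hB : B ∈ clusters X r) (hAB : A ≠ B) : Bigger A B ∨ Bigger B A := by
  rcases lt_trichotomy A.card B.card with h | h | h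
  · exact Or.inr (Or.inl h)
  · rcases lt_trichotomy A.min B.min with hm | hm | hm
    · exact Or.inl (Or.inr ⟨h, hm⟩)
    · exfalso
      have hne : A.Nonempty := by
        obtain ⟨k, rfl⟩ := mem_clusters.1 hA
        exact ⟨k, self_mem_cluster hr k⟩
      obtain ⟨k, hk⟩ := Finset.min_of_nonempty hne
      have hkA := Finset.mem_of_min hk
      have hkB := Finset.mem_of_min (hm ▸ hk)
      exact hAB ((eq_cluster_of_mem hr hA hkA).trans (eq_cluster_of_mem hr hB hkB).symm)
    · exact Or.inr (Or.inr ⟨h.symm, hm⟩)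
  · exact Or.inl (Or.inl h)

lemma rank_lt_rank {X : Fin n → E D} {r : ℝ} {A B : Finset (Fin n)}
    (hA : A ∈ clusters X r) (hAB : Bigger A B) : rank X r A < rank X r B := by
  classical
  refine Finset.card_lt_card (Finset.ssubset_iff_subset_ne.2 ⟨?_, ?_⟩)
  · intro C hC
    rw [Finset.mem_filter] at hC ⊢
    exact ⟨hC.1, hC.2.trans hAB⟩
  · intro h
    have : A ∈ (clusters X r).filter fun C => Bigger C A := by
      rw [h]; exact Finset.mem_filter.2 ⟨hA, hAB⟩
    exact not_bigger_self A (Finset.mem_filter.1 this).2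

lemma rank_injOn {X : Fin n → E D} {r : ℝ} (hr : 0 ≤ r) :
    Set.InjOn (rank X r) (clusters X r : Set (Finset (Fin n))) := by
  intro A hA B hB h
  by_contra hAB
  rcases bigger_or_bigger hr hA hB hAB with h' | h'
  · exact (rank_lt_rank hA h').ne h
  · exact (rank_lt_rank hB h').ne' h

lemma image_rank_clusters {X : Fin n → E D} {r : ℝ} (hr : 0 ≤ r) :
    (clusters X r).image (rank X r) = Finset.range (clusters X r).card := by
  classical
  refine Finset.eq_of_subset_of_card_le ?_ ?_
  · intro m hm
    obtain ⟨A, hA, rfl⟩ := Finset.mem_image.1 hm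
    refine Finset.mem_range.2 (Finset.card_lt_card (Finset.filter_ssubset.2 ⟨A, hA, ?_⟩))
    exact not_bigger_self A
  · rw [Finset.card_range, Finset.card_image_of_injOn (rank_injOn hr)]

lemma mem_largest {X : Fin n → E D} {r : ℝ} {m : ℕ} {k : Fin n} :
    k ∈ largest X r m ↔ rank X r (cluster X r k) = m := by
  simp [largest]

lemma largest_rank {X : Fin n → E D} {r : ℝ} (hr : 0 ≤ r) {A : Finset (Fin n)}
    (hA : A ∈ clusters X r) : largest X r (rank X r A) = A := by
  ext k
  rw [mem_largest]
  constructor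
  · intro h
    rw [← rank_injOn hr (cluster_mem_clusters X r k) hA h]
    exact self_mem_cluster hr k
  · intro h
    rw [← eq_cluster_of_mem hr hA h]

lemma exists_rank_eq {X : Fin n → E D} {r : ℝ} (hr : 0 ≤ r) {m : ℕ}
    (hm : m < (clusters X r).card) : ∃ A ∈ clusters X r, rank X r A = m := by
  have : m ∈ (clusters X r).image (rank X r) := by
    rw [image_rank_clusters hr]; exact Finset.mem_range.2 hm
  simpa using this

/-- If more than `m` clusters have at least `μ` elements, so has the cluster of rank `m`. -/
lemma le_card_largest {X : Fin n → E D} {r : ℝ} (hr : 0 ≤ r) {m μ : ℕ}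
    {𝒜 : Finset (Finset (Fin n))} (h𝒜 : 𝒜 ⊆ clusters X r) (hm : m < 𝒜.card)
    (hμ : ∀ A ∈ 𝒜, μ ≤ A.card) : μ ≤ (largest X r m).card := by
  classical
  obtain ⟨B, hB, rfl⟩ := exists_rank_eq hr (hm.trans_le (Finset.card_le_card h𝒜))
  rw [largest_rank hr hB]
  by_contra! hlt
  refine absurd hm (not_lt.2 (Finset.card_le_card fun A hA => ?_))
  exact Finset.mem_filter.2 ⟨h𝒜 hA, Or.inl (hlt.trans_le (hμ A hA))⟩

/-- If the cluster of rank `m` is non-empty, all smaller ranks are taken by clusters that are at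
least as large. -/
lemma exists_cluster_of_rank_le {X : Fin n → E D} {r : ℝ} (hr : 0 ≤ r) {m j : ℕ}
    (hm : (largest X r m).Nonempty) (hj : j ≤ m) :
    ∃ A ∈ clusters X r, rank X r A = j ∧ (largest X r m).card ≤ A.card := by
  obtain ⟨k, hk⟩ := hm
  have hk' := mem_largest.1 hk
  have hB := cluster_mem_clusters X r k
  have hlt : m < (clusters X r).card := by
    have := Finset.mem_image_of_mem (rank X r) hB
    rwa [image_rank_clusters hr, Finset.mem_range, hk'] at this
  obtain ⟨A, hA, hAj⟩ := exists_rank_eq hr (hj.trans_lt hlt)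
  refine ⟨A, hA, hAj, ?_⟩
  rw [← hk', largest_rank hr hB]
  by_contra! hcard
  have := rank_lt_rank hB (Or.inl hcard : Bigger (cluster X r k) A)
  omega

/-! ### The radii of the single linkage process -/

lemma IsRadius.nonneg {X : Fin n → E D} {r : ℝ} (h : IsRadius X r) : 0 ≤ r := by
  cases h with
  | zero => exact le_rfl
  | next ρ t _ ht =>
    obtain ⟨k, l, -, rfl⟩ := ht.1
    exact dist_nonneg

lemma finite_setOf_isRadius (X : Fin n → E D) : {r | IsRadius X r}.Finite := by
  refine ((Set.finite_range fun p : Fin n × Fin n => dist (X p.1) (X p.2)).insert 0).subset ?_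
  intro r hr
  cases hr with
  | zero => exact Or.inl rfl
  | next ρ t _ ht =>
    obtain ⟨k, l, -, rfl⟩ := ht.1
    exact Or.inr ⟨(k, l), rfl⟩

/-- Between two successive radii of the process the clusters do not change. -/
lemma exists_isRadius_cluster_eq (X : Fin n → E D) {r : ℝ} (hr : 0 ≤ r) :
    ∃ ρ, IsRadius X ρ ∧ ρ ≤ r ∧ cluster X ρ = cluster X r := by
  have hfin : {ρ | IsRadius X ρ ∧ ρ ≤ r}.Finite :=
    (finite_setOf_isRadius X).subset fun _ h => h.1
  obtain ⟨ρ, ⟨hρ, hρr⟩, hmax⟩ := hfin.exists_maximal ⟨0, IsRadius.zero, hr⟩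
  refine ⟨ρ, hρ, hρr, ?_⟩
  have h0 := hρ.nonneg
  -- otherwise some edge of length at most `r` joins two clusters at radius `ρ`, and the process
  -- has a radius in `(ρ, r]`
  have key : ∀ k l, (proxGraph X r).Adj k l → cluster X ρ k = cluster X ρ l := by
    intro k l hkl
    by_contra hne
    set T : Set ℝ := {u | ∃ k l, cluster X ρ k ≠ cluster X ρ l ∧ u = dist (X k) (X l)}
    have hT : T.Finite := by
      refine (Set.finite_range fun p : Fin n × Fin n => dist (X p.1) (X p.2)).subset ?_
      rintro u ⟨a, b, -, rfl⟩
      exact ⟨(a, b), rfl⟩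
    obtain ⟨t, ht⟩ := hT.exists_minimal ⟨_, k, l, hne, rfl⟩
    have hleast : IsLeast T t := ⟨ht.prop, fun u hu => by
      rcases le_total t u with h | h
      · exact h
      · exact ht.le_of_le hu h⟩
    have htr : t ≤ r := (hleast.2 ⟨k, l, hne, rfl⟩).trans hkl.2
    have hρt : ρ < t := by
      obtain ⟨a, b, hab, rfl⟩ := hleast.1
      by_contra! hle
      exact hab ((cluster_eq_iff h0).2 (reachable_of_dist_le hle))
    exact absurd (hmax ⟨IsRadius.next ρ t hρ hleast, htr⟩ hρt.le) (not_le.2 hρt)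
  funext k
  refine Finset.Subset.antisymm (cluster_mono h0 hρr k) fun l hl => ?_
  obtain ⟨w⟩ := (mem_cluster_iff_reachable hr).1 hl
  have : cluster X ρ k = cluster X ρ l := by
    clear hl
    induction w with
    | nil => rfl
    | cons h _ ih => exact (key _ _ h).trans ih
  rw [this]
  exact self_mem_cluster h0 l

lemma largest_congr {X : Fin n → E D} {r t : ℝ} (h : cluster X r = cluster X t) (m : ℕ) :
    largest X r m = largest X t m := by
  ext k
  rw [mem_largest, mem_largest]
  unfold rank clusters
  rw [h]

lemma selectedRadius_mem (M : ℕ) (X : Fin n → E D) :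
    selectedRadius M X ∈ {ρ | IsRadius X ρ ∧ ∀ ρ', IsRadius X ρ' →
      (largest X ρ' (M - 1)).card ≤ (largest X ρ (M - 1)).card} := by
  refine Set.Nonempty.csSup_mem ?_ ((finite_setOf_isRadius X).subset fun _ h => h.1)
  exact (finite_setOf_isRadius X).exists_maximalFor
    (fun ρ => (largest X ρ (M - 1)).card) _ ⟨0, IsRadius.zero⟩ |>.imp fun ρ h =>
      ⟨h.prop, fun ρ' hρ' => by
        rcases le_total (largest X ρ' (M - 1)).card (largest X ρ (M - 1)).card with h' | h'
        · exact h'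
        · exact h.le_of_le hρ' h'⟩

lemma le_selectedRadius {M : ℕ} {X : Fin n → E D} {ρ : ℝ} (hρ : IsRadius X ρ)
    (h : ∀ ρ', IsRadius X ρ' → (largest X ρ' (M - 1)).card ≤ (largest X ρ (M - 1)).card) :
    ρ ≤ selectedRadius M X :=
  le_csSup ((finite_setOf_isRadius X).subset fun _ h => h.1).bddAbove ⟨hρ, h⟩

end Clusters

/-! ### A radius that separates the groups forces the OSL procedure to succeed -/

section Deterministic

variable {D n M : ℕ}

/-- If the cluster of rank `M - 1` is larger than the set `O` of observations outside the groups,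
each of the `M` largest clusters contains an observation of some group. -/
lemma exists_top_clusters {X : Fin n → E D} {I : Fin M → Finset (Fin n)} {O : Finset (Fin n)}
    (hcov : ∀ k, k ∈ O ∨ ∃ i, k ∈ I i) {ρ : ℝ} (hρ : 0 ≤ ρ)
    (h : O.card < (largest X ρ (M - 1)).card) :
    ∃ (a : Fin M → Fin n) (σ : Fin M → Fin M), ∀ j,
      rank X ρ (cluster X ρ (a j)) = j ∧ a j ∈ I (σ j) ∧
        (largest X ρ (M - 1)).card ≤ (cluster X ρ (a j)).card := by
  have hne : (largest X ρ (M - 1)).Nonempty := Finset.card_pos.1 (by omega)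
  have : ∀ j : Fin M, ∃ (a : Fin n) (i : Fin M), rank X ρ (cluster X ρ a) = j ∧ a ∈ I i ∧
      (largest X ρ (M - 1)).card ≤ (cluster X ρ a).card := by
    intro j
    obtain ⟨A, hA, hAj, hcard⟩ := exists_cluster_of_rank_le hρ hne (Nat.le_sub_one_of_lt j.2)
    obtain ⟨a, haA, haO⟩ : ∃ a ∈ A, a ∉ O := by
      by_contra! hsub
      exact absurd (Finset.card_le_card hsub) (by omega)
    obtain ⟨i, hi⟩ := (hcov a).resolve_left haO
    have hAa := eq_cluster_of_mem hρ hA haA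
    exact ⟨a, i, hAa ▸ hAj, hi, hAa ▸ hcard⟩
  choose a σ h using this
  exact ⟨a, σ, h⟩

/-- Suppose that at some radius `r` every group `I i` lies in one cluster, distinct groups lie in
distinct clusters, and the set `O` of the remaining observations is small. Then the groups lie in
distinct clusters among the `M` largest ones at the selected radius: below `r`, the `M` largest
clusters are contained in those at `r`, so that the criterion does not exceed its value at `r`;
above `r`, each of the `M` largest clusters at the selected radius contains a full group. -/
theorem exists_perm_subset_largest {X : Fin n → E D} {I : Fin M → Finset (Fin n)}
    {O : Finset (Fin n)} {r : ℝ} (hr : 0 ≤ r) (hcov : ∀ k, k ∈ O ∨ ∃ i, k ∈ I i)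
    (hjoin : ∀ i, ∀ k ∈ I i, ∀ l ∈ I i, l ∈ cluster X r k)
    (hsep : ∀ i j, i ≠ j → ∀ k ∈ I i, ∀ l ∈ I j, l ∉ cluster X r k)
    (hO : ∀ i, O.card < (I i).card)
    (hI : ∀ i j, (I i).card + O.card < 2 * (I j).card) :
    ∃ π : Equiv.Perm (Fin M), ∀ i, I i ⊆ largest X (selectedRadius M X) (π i) := by
  classical
  rcases Nat.eq_zero_or_pos M with rfl | hM
  · exact ⟨Equiv.refl _, fun i => i.elim0⟩
  have hne : ∀ i, (I i).Nonempty := fun i => Finset.card_pos.1 (by have := hO i; omega)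
  choose c hc using hne
  have hIC : ∀ i, I i ⊆ cluster X r (c i) := fun i l hl => hjoin i _ (hc i) l hl
  have hCinj : Function.Injective fun i => cluster X r (c i) := by
    intro i j hij
    by_contra hne
    refine hsep i j hne _ (hc i) _ (hc j) ?_
    have : cluster X r (c i) = cluster X r (c j) := hij
    rw [this]
    exact self_mem_cluster hr _
  have hCI : ∀ i, cluster X r (c i) ⊆ I i ∪ O := by
    intro i k hk
    rcases hcov k with h | ⟨j, hj⟩
    · exact Finset.mem_union_right _ h
    · by_cases hij : i = j
      · exact Finset.mem_union_left _ (hij ▸ hj)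
      · exact absurd hk (hsep i j hij _ (hc i) _ hj)
  have hLr : ∀ μ, (∀ i, μ ≤ (cluster X r (c i)).card) → μ ≤ (largest X r (M - 1)).card := by
    intro μ hμ
    refine le_card_largest hr (𝒜 := Finset.univ.image fun i => cluster X r (c i)) ?_ ?_ ?_
    · intro A hA
      obtain ⟨i, -, rfl⟩ := Finset.mem_image.1 hA
      exact cluster_mem_clusters _ _ _
    · rw [Finset.card_image_of_injective _ hCinj, Finset.card_univ, Fintype.card_fin]
      omega
    · intro A hA
      obtain ⟨i, -, rfl⟩ := Finset.mem_image.1 hA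
      exact hμ i
  obtain ⟨i₀, -, hi₀⟩ := Finset.exists_min_image Finset.univ (fun i => (I i).card)
    ⟨⟨0, hM⟩, Finset.mem_univ _⟩
  have hLI : (I i₀).card ≤ (largest X r (M - 1)).card :=
    hLr _ fun i => (hi₀ i (Finset.mem_univ _)).trans (Finset.card_le_card (hIC i))
  have hbelow : ∀ ρ, 0 ≤ ρ → ρ ≤ r →
      (largest X ρ (M - 1)).card ≤ (largest X r (M - 1)).card := by
    intro ρ hρ hρr
    by_contra! hlt
    obtain ⟨a, σ, h⟩ := exists_top_clusters (X := X) hcov hρ (by have := hO i₀; omega)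
    have hsub : ∀ j, cluster X ρ (a j) ⊆ cluster X r (c (σ j)) := fun j => by
      refine (cluster_mono hρ hρr _).trans ?_
      rw [cluster_eq_of_mem hr (hIC _ (h j).2.1)]
    -- two of the clusters at `ρ` inside one cluster at `r` would make the latter too large
    have hσ : Function.Injective σ := by
      intro j j' hjj
      by_contra hne
      have hdisj : Disjoint (cluster X ρ (a j)) (cluster X ρ (a j')) := by
        rw [Finset.disjoint_left]
        intro k hk hk'
        apply hne
        rw [← Fin.val_inj, ← (h j).1, ← (h j').1, ← cluster_eq_of_mem hρ hk,
          ← cluster_eq_of_mem hρ hk']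
      have h1 := Finset.card_le_card (Finset.union_subset (hsub j) (hjj ▸ hsub j'))
      rw [Finset.card_union_of_disjoint hdisj] at h1
      have h2 := (Finset.card_le_card (hCI (σ j))).trans (Finset.card_union_le _ _)
      have h3 := (h j).2.2
      have h4 := (h j').2.2
      have h5 := hI (σ j) i₀
      omega
    have hσs : Function.Surjective σ := Finite.surjective_of_injective hσ
    refine absurd (hLr _ fun i => ?_) (not_le.2 hlt)
    obtain ⟨j, rfl⟩ := hσs i
    exact (h j).2.2.trans (Finset.card_le_card (hsub j))
  obtain ⟨ρ₀, hρ₀, hρ₀r, hcl⟩ := exists_isRadius_cluster_eq X hr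
  obtain ⟨hrad, hmax⟩ := selectedRadius_mem M X
  set rhat := selectedRadius M X with hrhat
  have hL₀ : (largest X ρ₀ (M - 1)).card = (largest X r (M - 1)).card := by
    rw [largest_congr hcl]
  have hle : ρ₀ ≤ rhat := by
    by_contra! hlt
    refine absurd (le_selectedRadius hρ₀ fun ρ' hρ' => ?_) (not_le.2 hlt)
    rw [hL₀]
    exact (hmax ρ' hρ').trans (hbelow _ hrad.nonneg (hlt.le.trans hρ₀r))
  have hr0 := hrad.nonneg
  obtain ⟨a, σ, h⟩ := exists_top_clusters (X := X) hcov hr0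
    (by have := hO i₀; have := hmax ρ₀ hρ₀; omega)
  have hfull : ∀ j, I (σ j) ⊆ cluster X rhat (a j) := by
    intro j l hl
    have := hjoin _ _ (h j).2.1 _ hl
    rw [← hcl] at this
    exact cluster_mono hρ₀.nonneg hle _ this
  have hσ : Function.Injective σ := by
    intro j j' hjj
    have hmem : a j' ∈ cluster X rhat (a j) := hfull j (hjj ▸ (h j').2.1)
    rw [← Fin.val_inj, ← (h j).1, ← (h j').1, cluster_eq_of_mem hr0 hmem]
  set τ := Equiv.ofBijective σ (Finite.injective_iff_bijective.1 hσ) with hτ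
  refine ⟨τ.symm, fun i => ?_⟩
  have hi : σ (τ.symm i) = i := τ.apply_symm_apply i
  intro k hk
  rw [mem_largest, ← (h (τ.symm i)).1]
  rw [cluster_eq_of_mem hr0 (hfull (τ.symm i) (hi.symm ▸ hk))]

end Deterministic

/-! ### Chains of outliers between different groups -/

section Chains

variable {D n M : ℕ}

/-- A path in which a point with label `i` is followed by points `m` without a label, and later on
by a point with another label, has a segment without labels between two different labels. -/
lemma exists_unlabelled_segment {α ι : Type*} {R : α → α → Prop} {lab : α → ι → Prop} :
    ∀ (l m : List α) (a : α) (i : ι), lab a i → (∀ x ∈ m, ∀ j, ¬ lab x j) →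
      (a :: (m ++ l)).IsChain R → (a :: (m ++ l)).Nodup →
      (∃ b j, b ∈ l ∧ j ≠ i ∧ lab b j) →
      ∃ (a' b' : α) (m' : List α) (i' j' : ι), i' ≠ j' ∧ lab a' i' ∧ lab b' j' ∧
        (∀ x ∈ m', ∀ j, ¬ lab x j) ∧ (a' :: (m' ++ [b'])).IsChain R ∧
          (a' :: (m' ++ [b'])).Nodup := by
  intro l
  induction l with
  | nil => rintro m a i - - - - ⟨b, j, hb, -⟩; simp at hb
  | cons y l ih =>
    rintro m a i ha hm hch hnd ⟨b, j, hb, hji, hbj⟩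
    have hsplit : a :: (m ++ y :: l) = (a :: (m ++ [y])) ++ l := by simp
    have hsplit' : a :: (m ++ y :: l) = (a :: m) ++ (y :: l) := by simp
    by_cases hy : ∃ j', j' ≠ i ∧ lab y j'
    · obtain ⟨j', hj', hyj⟩ := hy
      refine ⟨a, y, m, i, j', hj'.symm, ha, hyj, hm, ?_, ?_⟩
      · rw [hsplit] at hch
        exact hch.left_of_append
      · rw [hsplit] at hnd
        exact hnd.of_append_left
    have hbl : b ∈ l := by
      rcases List.mem_cons.1 hb with rfl | h
      · exact absurd ⟨j, hji, hbj⟩ hy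
      · exact h
    by_cases hyi : lab y i
    · refine ih [] y i hyi (by simp) ?_ ?_ ⟨b, j, hbl, hji, hbj⟩
      · rw [hsplit'] at hch
        exact hch.right_of_append
      · rw [hsplit'] at hnd
        exact hnd.of_append_right
    · refine ih (m ++ [y]) a i ha ?_ ?_ ?_ ⟨b, j, hbl, hji, hbj⟩
      · intro x hx j'
        rcases List.mem_append.1 hx with h | h
        · exact hm x h j'
        · obtain rfl : x = y := by simpa using h
          intro hj'
          by_cases hji' : j' = i
          · exact hyi (hji' ▸ hj')
          · exact hy ⟨j', hji', hj'⟩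
      · simpa using hch
      · simpa using hnd

lemma dist_le_of_isChain {X : Fin n → E D} {r : ℝ} {b : Fin n} :
    ∀ (l : List (Fin n)) (a : Fin n), (a :: (l ++ [b])).IsChain (proxGraph X r).Adj →
      dist (X a) (X b) ≤ (l.length + 1) * r := by
  intro l
  induction l with
  | nil =>
    intro a h
    have : (proxGraph X r).Adj a b := by simpa using h
    simpa using this.2
  | cons c l ih =>
    intro a h
    rw [List.cons_append, List.isChain_cons_cons] at h
    have h1 := ih c h.2
    have h2 : dist (X a) (X c) ≤ r := h.1.2
    have h3 := dist_triangle (X a) (X c) (X b)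
    push_cast [List.length_cons]
    linarith

/-- If a cluster at radius `r` contains observations of two groups, there is a chain of distinct
outliers whose length is of the order of the distance of the groups divided by `r`. -/
theorem exists_outlier_chain {X : Fin n → E D} {V : Fin M → Set (E D)} {δ r : ℝ} (hr : 0 ≤ r)
    (hδ : ∀ i j, i ≠ j → ∀ x ∈ V i, ∀ y ∈ V j, δ ≤ dist x y) {K : ℕ}
    (hK : (K + 1) * r < δ) {i j : Fin M} (hij : i ≠ j) {k l : Fin n}
    (hk : X k ∈ V i) (hl : X l ∈ V j) (hkl : l ∈ cluster X r k) :
    ∃ f : Fin (K + 1) → Fin n, Function.Injective f ∧ (∀ t, X (f t) ∈ (⋃ i, V i)ᶜ) ∧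
      ∀ t : Fin K, dist (X (f t.succ)) (X (f t.castSucc)) ≤ r := by
  classical
  obtain ⟨p⟩ := (mem_cluster_iff_reachable hr).1 hkl
  obtain ⟨p, hp⟩ : ∃ p : (proxGraph X r).Walk k l, p.IsPath := ⟨p.bypass, p.bypass_isPath⟩
  have hkl' : k ≠ l := by
    rintro rfl
    have := hδ i j hij _ hk _ hl
    rw [dist_self] at this
    have : 0 ≤ (K + 1) * r := by positivity
    linarith
  have hsupp : k :: ([] ++ p.support.tail) = p.support := by
    rw [List.nil_append, p.cons_tail_support]
  obtain ⟨a, b, m, i', j', hij', ha, hb, hm, hch, hnd⟩ :=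
    exists_unlabelled_segment (R := (proxGraph X r).Adj) (lab := fun x i => X x ∈ V i)
      p.support.tail [] k i hk (by simp) (by rw [hsupp]; exact p.isChain_adj_support)
      (by rw [hsupp]; exact hp.support_nodup)
      ⟨l, j, by
        have h := p.end_mem_support
        rw [← p.cons_tail_support] at h
        exact (List.mem_cons.1 h).resolve_left hkl'.symm, hij.symm, hl⟩
  have hlen : K + 1 ≤ m.length := by
    by_contra! hlt
    have h1 := (hδ i' j' hij' _ ha _ hb).trans (dist_le_of_isChain m a hch)
    have h2 : ((m.length : ℝ) + 1) ≤ K + 1 := by exact_mod_cast hlt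
    nlinarith
  have hmch : m.IsChain (proxGraph X r).Adj := by
    have : (a :: (m ++ [b])) = [a] ++ (m ++ [b]) := rfl
    rw [this] at hch
    exact hch.right_of_append.left_of_append
  have hmnd : m.Nodup := by
    have : (a :: (m ++ [b])) = [a] ++ (m ++ [b]) := rfl
    rw [this] at hnd
    exact hnd.of_append_right.of_append_left
  refine ⟨fun t => m[t.1]'(t.2.trans_le hlen), ?_, ?_, ?_⟩
  · intro s t hst
    exact Fin.ext ((hmnd.getElem_inj_iff).1 hst)
  · intro t ht
    obtain ⟨j, hj⟩ := Set.mem_iUnion.1 ht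
    exact hm _ (List.getElem_mem _) j hj
  · intro t
    have := (List.isChain_iff_getElem.1 hmch t.1 (by have := t.2; omega)).2
    rw [dist_comm]
    exact this

end Chains

/-! ### Probability estimates for independent samples -/

section Samples

variable {α : Type*} [MeasurableSpace α] (Q : Measure α) [IsProbabilityMeasure Q]

/-- The probability that a region of mass at least `p` contains none of `n` independent points. -/
lemma pi_forall_notMem_le {B : Set α} (hB : MeasurableSet B) {p : ℝ}
    (hp : ENNReal.ofReal p ≤ Q B) (n : ℕ) :
    Measure.pi (fun _ : Fin n => Q) {X | ∀ k, X k ∉ B} ≤ ENNReal.ofReal (Real.exp (-(n * p))) := by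
  have hset : {X : Fin n → α | ∀ k, X k ∉ B} = Set.univ.pi fun _ => Bᶜ := by
    ext X; simp
  have hle : Q Bᶜ ≤ ENNReal.ofReal (Real.exp (-p)) := by
    rw [prob_compl_eq_one_sub hB]
    calc 1 - Q B ≤ 1 - ENNReal.ofReal p := tsub_le_tsub_left hp 1
      _ ≤ ENNReal.ofReal (1 - p) := by
        rw [tsub_le_iff_right]
        calc (1 : ℝ≥0∞) = ENNReal.ofReal (1 - p + p) := by simp
          _ ≤ _ := ENNReal.ofReal_add_le
      _ ≤ ENNReal.ofReal (Real.exp (-p)) :=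
        ENNReal.ofReal_le_ofReal (by linarith [Real.add_one_le_exp (-p)])
  rw [hset, Measure.pi_pi, Finset.prod_const, Finset.card_univ, Fintype.card_fin]
  calc Q Bᶜ ^ n ≤ ENNReal.ofReal (Real.exp (-p)) ^ n := by gcongr
    _ = ENNReal.ofReal (Real.exp (-(n * p))) := by
      rw [← ENNReal.ofReal_pow (Real.exp_pos _).le, ← Real.exp_nat_mul]
      congr 2; ring

open Classical in
/-- Chebyshev's inequality for the number of sample points in a set. -/
lemma pi_abs_count_sub_ge_le {A : Set α} (hA : MeasurableSet A) {n : ℕ} {t : ℝ} (ht : 0 < t)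
    (hn : 0 < n) :
    Measure.pi (fun _ : Fin n => Q) {X | t * n ≤
        |((Finset.univ.filter fun k => X k ∈ A).card : ℝ) - n * (Q A).toReal|} ≤
      ENNReal.ofReal (1 / (t ^ 2 * n)) := by
  set g : α → ℝ := A.indicator 1 with hg
  have hgm : Measurable g := measurable_one.indicator hA
  have hgb : ∀ x, g x ∈ Set.Icc (0 : ℝ) 1 := fun x => by
    by_cases hx : x ∈ A <;> simp [hg, hx]
  have hL : MemLp g 2 Q :=
    memLp_of_bounded (ae_of_all _ hgb) hgm.aestronglyMeasurable 2
  set F : (Fin n → α) → ℝ := ∑ k : Fin n, fun X => g (X k) with hF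
  have hcount : ∀ X, F X = ((Finset.univ.filter fun k => X k ∈ A).card : ℝ) := by
    intro X
    simp only [hF, Finset.sum_apply, hg, Set.indicator_apply, Pi.one_apply]
    rw [Finset.sum_boole]
  have hLk : ∀ k : Fin n, MemLp (fun X : Fin n → α => g (X k)) 2
      (Measure.pi (fun _ : Fin n => Q)) := fun k =>
    hL.comp_measurePreserving (measurePreserving_eval (fun _ : Fin n => Q) k)
  have hLF : MemLp F 2 (Measure.pi (fun _ : Fin n => Q)) :=
    memLp_finsetSum' _ fun k _ => hLk k
  have hmean : (∫ X, F X ∂(Measure.pi (fun _ : Fin n => Q))) = n * (Q A).toReal := by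
    have h1 : ∀ k : Fin n, (∫ X, g (X k) ∂(Measure.pi (fun _ : Fin n => Q))) = (Q A).toReal := by
      intro k
      rw [integral_comp_eval (μ := fun _ : Fin n => Q) (i := k) (f := g)
        hgm.aestronglyMeasurable, hg, integral_indicator_one hA]
      rfl
    simp only [hF, Finset.sum_apply]
    rw [integral_finsetSum _ fun k _ => (hLk k).integrable (by norm_num)]
    simp [h1]
  have hvar : ProbabilityTheory.variance F (Measure.pi (fun _ : Fin n => Q)) ≤ n := by
    rw [hF, ProbabilityTheory.variance_sum_pi (X := fun _ : Fin n => g) fun _ => hL]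
    have h1 := ProbabilityTheory.variance_le_sq_of_bounded (μ := Q) (ae_of_all _ hgb)
      hgm.aemeasurable
    calc ∑ _k : Fin n, ProbabilityTheory.variance g Q ≤ ∑ _k : Fin n, (1 : ℝ) :=
          Finset.sum_le_sum fun _ _ => h1.trans (by norm_num)
      _ = n := by simp
  have hn' : (0 : ℝ) < n := by exact_mod_cast hn
  have := ProbabilityTheory.meas_ge_le_variance_div_sq hLF (c := t * n) (by positivity)
  rw [hmean] at this
  simp only [hcount] at this
  refine this.trans (ENNReal.ofReal_le_ofReal ?_)
  rw [div_le_div_iff₀ (by positivity) (by positivity)]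
  calc _ ≤ (n : ℝ) * (t ^ 2 * n) := by gcongr
    _ = 1 * (t * n) ^ 2 := by ring

/-- A subfamily of an independent sample is an independent sample. -/
lemma pi_map_comp_injective {n K : ℕ} {f : Fin K → Fin n} (hf : Function.Injective f) :
    (Measure.pi (fun _ : Fin n => Q)).map (fun X t => X (f t)) =
      Measure.pi (fun _ : Fin K => Q) := by
  have hind : ProbabilityTheory.iIndepFun (fun (k : Fin n) (X : Fin n → α) => X k)
      (Measure.pi (fun _ : Fin n => Q)) :=
    ProbabilityTheory.iIndepFun_pi (X := fun _ => id) fun _ => aemeasurable_id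
  have h := (ProbabilityTheory.iIndepFun_iff_map_fun_eq_pi_map
    (f := fun t (X : Fin n → α) => X (f t))
    fun t => (measurable_pi_apply (f t)).aemeasurable).1 (hind.precomp hf)
  rw [h]
  congr
  funext t
  exact (measurePreserving_eval (fun _ : Fin n => Q) (f t)).map_eq

end Samples

section ChainProb

variable {D : ℕ} (Q : Measure (E D)) [IsProbabilityMeasure Q]

/-- The sequences of `K + 1` points of `O` with steps of length at most `r`. -/
def chainSet (O : Set (E D)) (r : ℝ) (K : ℕ) : Set (Fin (K + 1) → E D) :=
  {x | (∀ t, x t ∈ O) ∧ ∀ t : Fin K, dist (x t.succ) (x t.castSucc) ≤ r}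

lemma measurableSet_chainSet {O : Set (E D)} (hO : MeasurableSet O) (r : ℝ) (K : ℕ) :
    MeasurableSet (chainSet O r K) := by
  have hset : chainSet O r K = (⋂ t, (fun x : Fin (K + 1) → E D => x t) ⁻¹' O) ∩
      ⋂ t : Fin K, {x | dist (x t.succ) (x t.castSucc) ≤ r} := by
    ext x
    simp [chainSet]
  rw [hset]
  exact (MeasurableSet.iInter fun t => measurable_pi_apply t hO).inter
    (MeasurableSet.iInter fun t => measurableSet_le
      ((measurable_pi_apply _).dist (measurable_pi_apply _)) measurable_const)

/-- Each further step of a chain costs a factor `q`. -/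
lemma pi_chainSet_le {O : Set (E D)} (hO : MeasurableSet O) {r : ℝ} {q : ℝ≥0∞}
    (hq : ∀ x, Q (O ∩ Metric.closedBall x r) ≤ q) (K : ℕ) :
    Measure.pi (fun _ : Fin (K + 1) => Q) (chainSet O r K) ≤ q ^ K := by
  induction K with
  | zero => simpa using prob_le_one
  | succ K ih =>
    set T : Set (E D × (Fin (K + 1) → E D)) :=
      {p | p.2 ∈ chainSet O r K ∧ p.1 ∈ O ∧ dist p.1 (p.2 (Fin.last K)) ≤ r}
    have hT : MeasurableSet T := by
      have hdist : MeasurableSet {p : E D × (Fin (K + 1) → E D) |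
          dist p.1 (p.2 (Fin.last K)) ≤ r} :=
        measurableSet_le (measurable_fst.dist ((measurable_pi_apply _).comp measurable_snd))
          measurable_const
      exact (measurable_snd (measurableSet_chainSet hO r K)).inter
        ((measurable_fst hO).inter hdist)
    have hmp := measurePreserving_piFinSuccAbove (fun _ : Fin (K + 1 + 1) => Q) (Fin.last (K + 1))
    have hsub : chainSet O r (K + 1) ⊆
        MeasurableEquiv.piFinSuccAbove (fun _ => E D) (Fin.last (K + 1)) ⁻¹' T := by
      intro x hx
      refine ⟨⟨fun t => ?_, fun t => ?_⟩, hx.1 _, ?_⟩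
      · exact hx.1 _
      · have := hx.2 t.castSucc
        simpa [Fin.removeNth_last, Fin.init] using this
      · have := hx.2 (Fin.last K)
        simpa [Fin.removeNth_last, Fin.init] using this
    calc _ ≤ _ := measure_mono hsub
      _ = (Q.prod (Measure.pi fun _ : Fin (K + 1) => Q)) T := hmp.measure_preimage_equiv T
      _ = ∫⁻ y, Q ((fun x => (x, y)) ⁻¹' T) ∂(Measure.pi fun _ : Fin (K + 1) => Q) :=
        Measure.prod_apply_symm hT
      _ ≤ ∫⁻ y, (chainSet O r K).indicator (fun _ => q) y
            ∂(Measure.pi fun _ : Fin (K + 1) => Q) := by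
        refine lintegral_mono fun y => ?_
        by_cases hy : y ∈ chainSet O r K
        · rw [Set.indicator_of_mem hy]
          refine le_trans (measure_mono ?_) (hq (y (Fin.last K)))
          exact fun x hx => ⟨hx.2.1, hx.2.2⟩
        · rw [Set.indicator_of_notMem hy, nonpos_iff_eq_zero]
          convert measure_empty (μ := Q)
          ext x
          exact ⟨fun hx => hy hx.1, fun hx => hx.elim⟩
      _ = q * Measure.pi (fun _ : Fin (K + 1) => Q) (chainSet O r K) := by
        rw [lintegral_indicator (measurableSet_chainSet hO r K), setLIntegral_const]
      _ ≤ q ^ (K + 1) := by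
        rw [pow_succ']
        gcongr

/-- A union bound over all chains of `K + 1` distinct observations in `O`. -/
lemma pi_exists_chain_le {O : Set (E D)} (hO : MeasurableSet O) {r : ℝ} {q : ℝ≥0∞}
    (hq : ∀ x, Q (O ∩ Metric.closedBall x r) ≤ q) (n K : ℕ) :
    Measure.pi (fun _ : Fin n => Q) {X | ∃ f : Fin (K + 1) → Fin n, Function.Injective f ∧
      (∀ t, X (f t) ∈ O) ∧ ∀ t : Fin K, dist (X (f t.succ)) (X (f t.castSucc)) ≤ r} ≤
      n * (n * q) ^ K := by
  classical
  calc _ ≤ Measure.pi (fun _ : Fin n => Q)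
        (⋃ f : {f : Fin (K + 1) → Fin n // Function.Injective f},
          (fun X t => X (f.1 t)) ⁻¹' chainSet O r K) := by
        refine measure_mono fun X hX => ?_
        obtain ⟨f, hf, h⟩ := hX
        exact Set.mem_iUnion.2 ⟨⟨f, hf⟩, h⟩
    _ ≤ ∑ f : {f : Fin (K + 1) → Fin n // Function.Injective f},
          Measure.pi (fun _ : Fin n => Q) ((fun X t => X (f.1 t)) ⁻¹' chainSet O r K) :=
        measure_iUnion_fintype_le _ _
    _ ≤ ∑ _f : {f : Fin (K + 1) → Fin n // Function.Injective f}, q ^ K := by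
        refine Finset.sum_le_sum fun f _ => ?_
        rw [← Measure.map_apply (f := fun (X : Fin n → E D) t => X (f.1 t))
          (measurable_pi_lambda _ fun t => measurable_pi_apply _) (measurableSet_chainSet hO r K), pi_map_comp_injective Q f.2]
        exact pi_chainSet_le Q hO hq K
    _ ≤ (n : ℝ≥0∞) ^ (K + 1) * q ^ K := by
        rw [Finset.sum_const, nsmul_eq_mul, Finset.card_univ]
        gcongr
        have := Fintype.card_subtype_le (fun f : Fin (K + 1) → Fin n => Function.Injective f)
        rw [Fintype.card_fun, Fintype.card_fin, Fintype.card_fin] at this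
        exact_mod_cast this
    _ = n * (n * q) ^ K := by rw [mul_pow, pow_succ']; ring

end ChainProb

/-! ### Volumes and coverings -/

section Geometry

lemma ballVol_pos {s : ℝ} (hs : 0 ≤ s) : 0 < ballVol s :=
  div_pos (Real.rpow_pos_of_pos Real.pi_pos _) (Real.Gamma_pos_of_pos (by linarith))

lemma ballVol_zero : ballVol 0 = 1 := by
  simp [ballVol]

lemma exists_pos_le_ballVol (D : ℕ) :
    ∃ m : ℝ, 0 < m ∧ ∀ s : ℝ, 0 ≤ s → s ≤ D → m ≤ ballVol s := by
  have hcont : ContinuousOn ballVol (Set.Icc (0 : ℝ) D) := by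
    intro s hs
    refine ContinuousAt.continuousWithinAt (ContinuousAt.div ?_ ?_ ?_)
    · exact (Real.continuous_const_rpow Real.pi_pos.ne').continuousAt.comp
        (continuous_id.div_const 2).continuousAt
    · have hG : ContinuousAt Real.Gamma (1 + s / 2) :=
        (Real.differentiableAt_Gamma fun k h => by
          have h0 : (0 : ℝ) ≤ k := k.cast_nonneg
          have := hs.1
          linarith).continuousAt
      exact ContinuousAt.comp' (f := fun s : ℝ => 1 + s / 2) hG (by fun_prop)
    · have := hs.1
      exact (Real.Gamma_pos_of_pos (by linarith)).ne'
  obtain ⟨s, hs, hmin⟩ := isCompact_Icc.exists_isMinOn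
    (Set.nonempty_Icc.2 (Nat.cast_nonneg (α := ℝ) D)) hcont
  exact ⟨ballVol s, ballVol_pos hs.1, fun u hu hu' => hmin ⟨hu, hu'⟩⟩

/-- The Hausdorff measure of the ambient dimension is translation invariant and homogeneous. -/
lemma exists_hausdorff_closedBall_le (D : ℕ) :
    ∃ C : ℝ, 0 < C ∧ ∀ (x : E D) (r : ℝ), 0 ≤ r →
      hausdorff (D : ℝ) (Metric.closedBall x r) ≤ ENNReal.ofReal (C * r ^ D) := by
  set μ : Measure (E D) := Measure.hausdorffMeasure (D : ℝ) with hμ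
  set v : ℝ := (μ (Metric.closedBall 0 1)).toReal
  have hv : μ (Metric.closedBall 0 1) = ENNReal.ofReal v :=
    (ENNReal.ofReal_toReal (isCompact_closedBall _ _).measure_lt_top.ne).symm
  have hw : 0 ≤ ballVol D / 2 ^ (D : ℝ) := by
    have := ballVol_pos (Nat.cast_nonneg (α := ℝ) D)
    positivity
  have hv0 : 0 ≤ v := ENNReal.toReal_nonneg
  refine ⟨ballVol D / 2 ^ (D : ℝ) * v + 1, by positivity, fun x r hr => ?_⟩
  have h := Measure.addHaar_closedBall' μ x hr
  rw [finrank_euclideanSpace_fin, hv] at h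
  rw [hausdorff, ← hμ, h, ← ENNReal.ofReal_mul (by positivity), ← ENNReal.ofReal_mul hw]
  refine ENNReal.ofReal_le_ofReal ?_
  have : 0 ≤ r ^ D := by positivity
  nlinarith

/-- Subsets of the unit cube are covered by `(m + 1) ^ D` balls of radius of the order `1 / m`,
one for each cell of a grid of mesh `1 / m`. -/
lemma exists_finset_cover_of_subset_cube {D : ℕ} {A : Set (E D)} (hA : A ⊆ cube D) {m : ℕ}
    (hm : 0 < m) :
    ∃ C : Finset (E D), C.card ≤ (m + 1) ^ D ∧ (∀ c ∈ C, c ∈ A) ∧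
      ∀ x ∈ A, ∃ c ∈ C, dist x c ≤ Real.sqrt D / m := by
  classical
  have hm' : (0 : ℝ) < m := by exact_mod_cast hm
  have hfloor : ∀ x ∈ A, ∀ j, ⌊x j * m⌋₊ < m + 1 := by
    intro x hx j
    have h1 := hA hx j
    rw [Nat.lt_succ_iff]
    refine Nat.floor_le_of_le ?_
    nlinarith [h1.2]
  set φ : A → (Fin D → Fin (m + 1)) := fun x j => ⟨⌊x.1 j * m⌋₊, hfloor x.1 x.2 j⟩ with hφ
  have hrep : ∀ z : Set.range φ, ∃ x : A, φ x = z.1 := fun z => z.2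
  choose g hg using hrep
  refine ⟨Finset.univ.image fun z : Set.range φ => (g z).1, ?_, ?_, ?_⟩
  · refine Finset.card_image_le.trans ?_
    rw [Finset.card_univ]
    refine (Fintype.card_subtype_le _).trans ?_
    simp
  · intro c hc
    obtain ⟨z, -, rfl⟩ := Finset.mem_image.1 hc
    exact (g z).2
  · intro x hx
    refine ⟨_, Finset.mem_image_of_mem _ (Finset.mem_univ (⟨φ ⟨x, hx⟩, _, rfl⟩ : Set.range φ)), ?_⟩
    set y := g ⟨φ ⟨x, hx⟩, _, rfl⟩ with hy
    have hcoord : ∀ j, dist (x j) (y.1 j) ^ 2 ≤ (1 / (m : ℝ)) ^ 2 := by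
      intro j
      have hfl : ⌊y.1 j * m⌋₊ = ⌊x j * m⌋₊ :=
        congrArg (fun z => (z j).val) (hg ⟨φ ⟨x, hx⟩, _, rfl⟩)
      have hx0 : 0 ≤ x j * m := mul_nonneg (hA hx j).1 hm'.le
      have hy0 : 0 ≤ y.1 j * m := mul_nonneg (hA y.2 j).1 hm'.le
      have h1 := Nat.floor_le hx0
      have h2 := Nat.lt_floor_add_one (x j * m)
      have h3 := Nat.floor_le hy0
      have h4 := Nat.lt_floor_add_one (y.1 j * m)
      rw [hfl] at h3 h4
      refine pow_le_pow_left₀ dist_nonneg ?_ 2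
      rw [Real.dist_eq, le_div_iff₀ hm', ← abs_of_pos hm', ← abs_mul, abs_le]
      constructor <;> nlinarith
    rw [EuclideanSpace.dist_eq]
    calc Real.sqrt (∑ j, dist (x j) (y.1 j) ^ 2) ≤ Real.sqrt (∑ _j : Fin D, (1 / (m : ℝ)) ^ 2) :=
          Real.sqrt_le_sqrt (Finset.sum_le_sum fun j _ => hcoord j)
      _ = Real.sqrt D / m := by
        rw [Finset.sum_const, Finset.card_univ, Fintype.card_fin, nsmul_eq_mul,
          Real.sqrt_mul (Nat.cast_nonneg _), Real.sqrt_sq (by positivity)]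
        ring

end Geometry

/-! ### The observations of the mixture model -/

section Model

variable {D M : ℕ} {P₀ : Measure (E D)} {P : Fin M → Measure (E D)} {γ : Fin M → ℝ}

lemma isClosed_S (i : Fin M) : IsClosed (S P i) := Measure.isClosed_support

lemma measure_compl_S (i : Fin M) : P i (S P i)ᶜ = 0 := Measure.measure_compl_support

lemma isClosed_cube (D : ℕ) : IsClosed (cube D) := by
  have : cube D = ⋂ j, {x : E D | x j ∈ Set.Icc (0 : ℝ) 1} := by
    ext x; simp [cube]
  rw [this]
  exact isClosed_iInter fun j => isClosed_Icc.preimage (by fun_prop)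

lemma IsModel.S_subset_cube (h : IsModel P₀ P γ) (i : Fin M) : S P i ⊆ cube D :=
  Measure.support_subset_of_isClosed (isClosed_cube D) (mem_ae_iff.2 (h.cube_compl i))

lemma IsModel.outlier_S (h : IsModel P₀ P γ) (i : Fin M) : P₀ (S P i) = 0 := by
  have h1 : P₀ (closure (outlierSet P))ᶜ = 0 :=
    measure_mono_null (Set.compl_subset_compl.2 h.support_outlier) Measure.measure_compl_support
  refine measure_mono_null ?_ (measure_union_null (h.outlier_null i) h1)
  intro x hx
  by_cases hxc : x ∈ closure (outlierSet P)
  · exact Or.inl ⟨hxc, hx⟩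
  · exact Or.inr hxc

lemma IsModel.outlier_cube_compl (h : IsModel P₀ P γ) : P₀ (cube D)ᶜ = 0 := by
  refine measure_mono_null (Set.compl_subset_compl.2 ?_) Measure.measure_compl_support
  refine h.support_outlier.trans (closure_minimal ?_ (isClosed_cube D))
  exact Set.sep_subset _ _

lemma mixture_apply (P₀ : Measure (E D)) (P : Fin M → Measure (E D)) (γ : Fin M → ℝ) (ε : ℝ)
    (A : Set (E D)) : mixture P₀ P γ ε A =
      ENNReal.ofReal ε * P₀ A + ENNReal.ofReal (1 - ε) * ∑ i, ENNReal.ofReal (γ i) * P i A := by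
  simp [mixture]

lemma IsModel.isProbabilityMeasure_mixture (h : IsModel P₀ P γ) {ε : ℝ} (h0 : 0 ≤ ε)
    (h1 : ε ≤ 1) : IsProbabilityMeasure (mixture P₀ P γ ε) := by
  have := h.prob_outlier
  have := h.prob
  refine ⟨?_⟩
  rw [mixture_apply]
  simp only [measure_univ, mul_one]
  rw [← ENNReal.ofReal_sum_of_nonneg fun i _ => h.weight_nonneg i, h.weight_sum,
    ENNReal.ofReal_one, mul_one, ← ENNReal.ofReal_add h0 (by linarith)]
  simp

lemma A1.disjoint (h : A1 P) {i j : Fin M} (hij : i ≠ j) : Disjoint (S P i) (S P j) := by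
  obtain ⟨-, δ, hδ, hd⟩ := h
  rw [Set.disjoint_left]
  intro x hx hx'
  have := hd i j hij x hx x hx'
  rw [dist_self] at this
  linarith

lemma IsModel.mixture_S (h : IsModel P₀ P γ) (h1 : A1 P) {ε : ℝ} (hε : ε ≤ 1) (i : Fin M) :
    (mixture P₀ P γ ε (S P i)).toReal = (1 - ε) * γ i := by
  have hprob := h.prob i
  have hPi : P i (S P i) = 1 := by
    rw [← prob_compl_eq_zero_iff (isClosed_S i).measurableSet]
    exact measure_compl_S i
  rw [mixture_apply, h.outlier_S, mul_zero, zero_add, Finset.sum_eq_single i, hPi, mul_one,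
    ← ENNReal.ofReal_mul (by linarith),
    ENNReal.toReal_ofReal (mul_nonneg (by linarith) (h.weight_nonneg i))]
  · intro j _ hji
    rw [measure_mono_null (h1.disjoint hji).symm.subset_compl_right (measure_compl_S j), mul_zero]
  · simp

/-- Outside the supports `S i` the mixture is at most `ε κ₀` times the Hausdorff measure. -/
lemma IsModel.mixture_outlier_closedBall_le (h : IsModel P₀ P γ) {κ₀ : ℝ} (h2 : A2 P₀ P κ₀)
    {ε : ℝ} (hε : 0 ≤ ε) {C : ℝ} (hC : ∀ (x : E D) (r : ℝ), 0 ≤ r →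
      hausdorff (D : ℝ) (Metric.closedBall x r) ≤ ENNReal.ofReal (C * r ^ D))
    {r : ℝ} (hr : 0 ≤ r) (x : E D) :
    mixture P₀ P γ ε ((⋃ i, S P i)ᶜ ∩ Metric.closedBall x r) ≤
      ENNReal.ofReal (ε * κ₀ * (C * r ^ D)) := by
  have hP : ∀ i, P i ((⋃ i, S P i)ᶜ ∩ Metric.closedBall x r) = 0 := fun i =>
    measure_mono_null (fun y hy hyi => hy.1 (Set.mem_iUnion.2 ⟨i, hyi⟩)) (measure_compl_S i)
  have hmeas : MeasurableSet (outlierSet P) :=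
    (isClosed_cube D).measurableSet.diff
      (MeasurableSet.iUnion fun i => (isClosed_S i).measurableSet)
  have hP₀ : P₀ ((⋃ i, S P i)ᶜ ∩ Metric.closedBall x r) ≤ ENNReal.ofReal (κ₀ * (C * r ^ D)) :=
    calc _ ≤ P₀ (outlierSet P ∩ Metric.closedBall x r ∪ (cube D)ᶜ) := by
          refine measure_mono fun y hy => ?_
          by_cases hyc : y ∈ cube D
          · exact Or.inl ⟨⟨hyc, hy.1⟩, hy.2⟩
          · exact Or.inr hyc
      _ ≤ P₀ (outlierSet P ∩ Metric.closedBall x r) + P₀ (cube D)ᶜ := measure_union_le _ _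
      _ = P₀ (outlierSet P ∩ Metric.closedBall x r) := by rw [h.outlier_cube_compl, add_zero]
      _ ≤ ENNReal.ofReal κ₀ * hausdorff (D : ℝ) (outlierSet P ∩ Metric.closedBall x r) :=
          h2.2 _ (hmeas.inter measurableSet_closedBall) Set.inter_subset_left
      _ ≤ ENNReal.ofReal κ₀ * hausdorff (D : ℝ) (Metric.closedBall x r) := by
          unfold hausdorff
          gcongr
          exact Set.inter_subset_right
      _ ≤ ENNReal.ofReal κ₀ * ENNReal.ofReal (C * r ^ D) := by
          gcongr
          exact hC x r hr
      _ = ENNReal.ofReal (κ₀ * (C * r ^ D)) := (ENNReal.ofReal_mul h2.1.le).symm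
  rw [mixture_apply]
  simp only [hP, mul_zero, Finset.sum_const_zero, add_zero]
  rw [mul_assoc, ENNReal.ofReal_mul hε]
  gcongr

lemma gammaMin_le (γ : Fin M → ℝ) (i : Fin M) : gammaMin γ ≤ γ i :=
  ciInf_le (Set.finite_range γ).bddBelow i

lemma le_gammaMax (γ : Fin M → ℝ) (i : Fin M) : γ i ≤ gammaMax γ :=
  le_ciSup (Set.finite_range γ).bddAbove i

lemma sdim_nonneg (P : Fin M → Measure (E D)) (i : Fin M) : 0 ≤ sdim P i :=
  ENNReal.toReal_nonneg

lemma sdim_le_maxDim (P : Fin M → Measure (E D)) (i : Fin M) : sdim P i ≤ maxDim P :=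
  le_ciSup (Set.finite_range (sdim P)).bddAbove i

lemma A6.gammaBar_pos {ε : ℝ} (h : A6 γ ε) : 0 < gammaBar γ := by
  have := h.1
  unfold gammaBar
  linarith

/-- The bound on `ε` in `A6`, in the form `1 - ε > 1 / (1 + γbar)`. -/
lemma A6.one_lt_mul {ε : ℝ} (h : A6 γ ε) : 1 < (1 - ε) * (1 + gammaBar γ) := by
  have hb := h.gammaBar_pos
  have := (lt_div_iff₀ (by linarith : 0 < 1 + gammaBar γ)).1 h.2.2
  linarith

lemma A6.lt_one {ε : ℝ} (h : A6 γ ε) : ε < 1 := by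
  have hb := h.gammaBar_pos
  have := h.one_lt_mul
  by_contra! hle
  nlinarith

/-- Around its points, `P i` has at least the mass that `A3` and `A4` give to a ball. A one-point
support, for which `A4` says nothing, has dimension `0`, so that the bound is `κᵢ⁻¹ κc⁻¹ ≤ 1`. -/
lemma le_measure_ball (h : IsModel P₀ P γ) {κ : Fin M → ℝ} {κc : ℝ} (h3 : A3 P κ) (h4 : A4 P κc)
    (i : Fin M) {x : E D} (hx : x ∈ S P i) {ρ : ℝ} (hρ : 0 < ρ)
    (hdiam : ρ ≤ Metric.diam (S P i) ∨ Metric.diam (S P i) = 0) :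
    ENNReal.ofReal ((κ i)⁻¹ * (κc⁻¹ * (ballVol (sdim P i) * ρ ^ sdim P i))) ≤
      P i (Metric.ball x ρ) := by
  have hκ := (h3 i).1
  have hSm : MeasurableSet (S P i) := (isClosed_S i).measurableSet
  rcases hdiam with hd | hd
  · calc _ = ENNReal.ofReal (κ i)⁻¹ *
          ENNReal.ofReal (κc⁻¹ * (ballVol (sdim P i) * ρ ^ sdim P i)) :=
          ENNReal.ofReal_mul (by positivity)
      _ ≤ ENNReal.ofReal (κ i)⁻¹ * hausdorff (sdim P i) (S P i ∩ Metric.ball x ρ) := by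
          gcongr
          exact (h4.2 i x hx ρ hρ hd).1
      _ ≤ P i (S P i ∩ Metric.ball x ρ) :=
          (h3 i).2 _ (hSm.inter measurableSet_ball) Set.inter_subset_left
      _ ≤ _ := measure_mono Set.inter_subset_right
  · have hbdd : Bornology.IsBounded (S P i) := by
      refine Bornology.IsBounded.subset ?_ (h.S_subset_cube i)
      refine (Metric.isBounded_iff_subset_closedBall 0).2 ⟨Real.sqrt D, fun y hy => ?_⟩
      rw [mem_closedBall_zero_iff, EuclideanSpace.norm_eq]
      refine Real.sqrt_le_sqrt ?_
      calc ∑ j, ‖y j‖ ^ 2 ≤ ∑ _j : Fin D, (1 : ℝ) := by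
            refine Finset.sum_le_sum fun j _ => ?_
            have := hy j
            rw [Real.norm_eq_abs, sq_abs]
            nlinarith [this.1, this.2]
        _ = D := by simp
    have hS : S P i = {x} := by
      refine Set.Subset.antisymm (fun y hy => ?_) (Set.singleton_subset_iff.2 hx)
      have := Metric.dist_le_diam_of_mem hbdd hy hx
      rw [hd] at this
      exact dist_le_zero.1 this
    have hs : sdim P i = 0 := by simp [sdim, hS]
    have hprob := h.prob i
    have hmass : P i (Metric.ball x ρ) = 1 := by
      rw [← prob_compl_eq_zero_iff measurableSet_ball]
      refine measure_mono_null (Set.compl_subset_compl.2 ?_) (measure_compl_S i)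
      rw [hS]
      exact Set.singleton_subset_iff.2 (Metric.mem_ball_self hρ)
    have hone : ENNReal.ofReal (κ i)⁻¹ ≤ 1 := by
      have := (h3 i).2 _ hSm subset_rfl
      rw [hs, hS, hausdorff, ballVol_zero, Measure.hausdorffMeasure_zero_singleton] at this
      simp only [Real.rpow_zero, div_one, ENNReal.ofReal_one, mul_one] at this
      exact this.trans prob_le_one
    rw [hmass, hs, ballVol_zero, Real.rpow_zero, mul_one, mul_one]
    rw [ENNReal.ofReal_le_one] at hone ⊢
    have hc : κc⁻¹ ≤ 1 := inv_le_one_of_one_le₀ h4.1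
    have hc0 : 0 ≤ κc⁻¹ := inv_nonneg.2 (by linarith [h4.1])
    have hκ' : 0 ≤ (κ i)⁻¹ := by positivity
    nlinarith

/-- The mass of small balls around the points of the groups, in terms of the constant `𝔞`. -/
lemma le_mixture_ball (h : IsModel P₀ P γ) {κ : Fin M → ℝ} {κc : ℝ} (h3 : A3 P κ)
    (h4 : A4 P κc) {ε : ℝ} (h6 : A6 γ ε) (hγ : 0 < gammaMin γ) {m : ℝ} (hm0 : 0 < m)
    (hm : ∀ s : ℝ, 0 ≤ s → s ≤ D → m ≤ ballVol s) (hd : maxDim P ≤ D)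
    (i : Fin M) {x : E D} (hx : x ∈ S P i) {ρ : ℝ} (hρ : 0 < ρ) (hρ1 : ρ ≤ 1)
    (hdiam : ρ ≤ Metric.diam (S P i) ∨ Metric.diam (S P i) = 0) :
    ENNReal.ofReal (constA P γ κ κc * m * ρ ^ maxDim P) ≤
      mixture P₀ P γ ε (Metric.ball x ρ) := by
  have hb := h6.gammaBar_pos
  have hε := h6.lt_one
  have hκ := (h3 i).1
  have hc := h4.1
  have hκle : κ i ≤ ⨆ i, κ i := le_ciSup (Set.finite_range κ).bddAbove i
  have hs0 := sdim_nonneg P i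
  have hsd := sdim_le_maxDim P i
  have hη := ballVol_pos (hs0.trans hsd)
  have hreal : constA P γ κ κc * m * ρ ^ maxDim P ≤
      (1 - ε) * (γ i * ((κ i)⁻¹ * (κc⁻¹ * (ballVol (sdim P i) * ρ ^ sdim P i)))) := by
    have e1 : gammaMin γ / (1 + gammaBar γ) ≤ (1 - ε) * γ i := by
      rw [div_le_iff₀ (by linarith)]
      have h1 := h6.one_lt_mul
      have h2 := gammaMin_le γ i
      nlinarith
    have e2 : ((⨆ i, κ i) * κc)⁻¹ ≤ (κ i)⁻¹ * κc⁻¹ := by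
      rw [← mul_inv]
      gcongr
    have e3 : min 1 (ballVol (maxDim P)) * m ≤ ballVol (sdim P i) :=
      (mul_le_of_le_one_left hm0.le (min_le_left _ _)).trans (hm _ hs0 (hsd.trans hd))
    have e4 : ρ ^ maxDim P ≤ ρ ^ sdim P i := Real.rpow_le_rpow_of_exponent_ge hρ hρ1 hsd
    have hsup : 0 < ⨆ i, κ i := hκ.trans_le hκle
    have hmin : 0 < min 1 (ballVol (maxDim P)) := lt_min one_pos hη
    have hs := ballVol_pos hs0
    have hu := (div_pos hγ (by linarith : 0 < 1 + gammaBar γ)).trans_le e1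
    have hu' : 0 ≤ (1 - ε) * γ i * ((κ i)⁻¹ * κc⁻¹) * ballVol (sdim P i) :=
      mul_nonneg (mul_nonneg hu.le (by positivity)) hs.le
    calc constA P γ κ κc * m * ρ ^ maxDim P
        = (gammaMin γ / (1 + gammaBar γ)) * ((⨆ i, κ i) * κc)⁻¹ *
            (min 1 (ballVol (maxDim P)) * m) * ρ ^ maxDim P := by unfold constA; ring
      _ ≤ ((1 - ε) * γ i) * ((κ i)⁻¹ * κc⁻¹) * ballVol (sdim P i) * ρ ^ sdim P i := by
          gcongr
      _ = _ := by ring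
  calc _ ≤ ENNReal.ofReal ((1 - ε) *
        (γ i * ((κ i)⁻¹ * (κc⁻¹ * (ballVol (sdim P i) * ρ ^ sdim P i))))) :=
        ENNReal.ofReal_le_ofReal hreal
    _ = ENNReal.ofReal (1 - ε) * (ENNReal.ofReal (γ i) * ENNReal.ofReal
        ((κ i)⁻¹ * (κc⁻¹ * (ballVol (sdim P i) * ρ ^ sdim P i)))) := by
        rw [ENNReal.ofReal_mul (by linarith), ENNReal.ofReal_mul (h.weight_nonneg i)]
    _ ≤ ENNReal.ofReal (1 - ε) * (ENNReal.ofReal (γ i) * P i (Metric.ball x ρ)) := by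
        gcongr
        exact le_measure_ball h h3 h4 i hx hρ hdiam
    _ ≤ ENNReal.ofReal (1 - ε) * ∑ j, ENNReal.ofReal (γ j) * P j (Metric.ball x ρ) := by
        gcongr
        exact Finset.single_le_sum (f := fun j => ENNReal.ofReal (γ j) * P j (Metric.ball x ρ))
          (fun _ _ => zero_le) (Finset.mem_univ i)
    _ ≤ _ := by
        rw [mixture_apply]
        exact le_add_self

end Model

/-! ### A bound for the clustering risk at a given sample size -/

section FiniteSample

variable {D M : ℕ} {P₀ : Measure (E D)} {P : Fin M → Measure (E D)} {γ : Fin M → ℝ}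

/-- If the group sizes are within `t n` of their means `n wᵢ`, the means fulfil the size
requirements of `exists_perm_subset_largest` with room to spare, and so do the sizes. -/
lemma card_lt_of_abs_sub_lt {n : ℕ} {I : Fin M → Finset (Fin n)}
    (hdisj : ∀ i j, i ≠ j → Disjoint (I i) (I j)) {w : Fin M → ℝ} {e t : ℝ}
    (hsum : ∑ i, w i = 1 - e) (hI : ∀ i, |((I i).card : ℝ) - n * w i| < t * n)
    (h1 : ∀ i, e + (M + 1) * t ≤ w i) (h2 : ∀ i j, w i + e + (M + 3) * t ≤ 2 * w j) :
    (∀ i, ((Finset.univ.biUnion I)ᶜ).card < (I i).card) ∧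
      ∀ i j, (I i).card + ((Finset.univ.biUnion I)ᶜ).card < 2 * (I j).card := by
  set O := (Finset.univ.biUnion I)ᶜ with hO
  have hcard : ((O.card : ℕ) : ℝ) + ∑ i, ((I i).card : ℝ) = n := by
    have hb : (Finset.univ.biUnion I).card = ∑ i, (I i).card :=
      Finset.card_biUnion fun i _ j _ hij => hdisj i j hij
    have := Finset.card_compl_add_card (Finset.univ.biUnion I)
    rw [hb, Fintype.card_fin] at this
    exact_mod_cast this
  have hOle : (O.card : ℝ) ≤ n * e + M * (t * n) := by
    have : ∑ i, (n * w i - t * n) ≤ ∑ i, ((I i).card : ℝ) :=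
      Finset.sum_le_sum fun i _ => by linarith [(abs_lt.1 (hI i)).1]
    rw [Finset.sum_sub_distrib, ← Finset.mul_sum, hsum] at this
    simp only [Finset.sum_const, Finset.card_univ, Fintype.card_fin, nsmul_eq_mul] at this
    linarith
  have hn : (0 : ℝ) ≤ n := n.cast_nonneg
  constructor
  · intro i
    have a1 := (abs_lt.1 (hI i)).1
    have a2 := mul_le_mul_of_nonneg_left (h1 i) hn
    have : (O.card : ℝ) < (I i).card := by linarith
    exact_mod_cast this
  · intro i j
    have a1 := (abs_lt.1 (hI i)).2
    have a2 := (abs_lt.1 (hI j)).1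
    have a3 := mul_le_mul_of_nonneg_left (h2 i j) hn
    have : ((I i).card : ℝ) + O.card < 2 * (I j).card := by linarith
    exact_mod_cast this

/-- The deviation of the group frequencies that `A6` leaves room for. -/
noncomputable def slack (γ : Fin M → ℝ) : ℝ := gammaBar γ / (1 + gammaBar γ) / (M + 3)

lemma A6.slack_pos {ε : ℝ} (h : A6 γ ε) : 0 < slack γ := by
  have := h.gammaBar_pos
  unfold slack
  positivity

lemma A6.add_slack_le {ε : ℝ} (h : A6 γ ε) (i j : Fin M) :
    ε + (M + 1) * slack γ ≤ (1 - ε) * γ i ∧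
      (1 - ε) * γ i + ε + (M + 3) * slack γ ≤ 2 * ((1 - ε) * γ j) := by
  have hb := h.gammaBar_pos
  have hs := h.slack_pos
  have h1 := h.one_lt_mul
  have hM : (0 : ℝ) ≤ M := M.cast_nonneg
  have hsl : (M + 3) * slack γ = gammaBar γ / (1 + gammaBar γ) := by
    unfold slack
    field_simp
  have hsl' : (M + 3) * slack γ ≤ (1 - ε) * gammaBar γ := by
    rw [hsl, div_le_iff₀ (by linarith)]
    nlinarith
  have hε : ε ≤ (1 - ε) * gammaBar γ := by linarith
  have hε1 : 0 ≤ 1 - ε := by linarith [h.lt_one]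
  have g1 := gammaMin_le γ i
  have g2 := le_gammaMax γ i
  have g3 := gammaMin_le γ j
  have hγb : gammaMax γ = 2 * gammaMin γ - 2 * gammaBar γ := by unfold gammaBar; ring
  have e1 : (1 - ε) * (2 * gammaBar γ) ≤ (1 - ε) * γ i :=
    mul_le_mul_of_nonneg_left (by linarith) hε1
  have e2 : (1 - ε) * (γ i + 2 * gammaBar γ) ≤ (1 - ε) * (2 * γ j) :=
    mul_le_mul_of_nonneg_left (by linarith) hε1
  constructor
  · nlinarith
  · nlinarith

open Classical in
/-- The observations in `S i`. -/
noncomputable def groupObs (P : Fin M → Measure (E D)) {n : ℕ} (X : Fin n → E D) (i : Fin M) :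
    Finset (Fin n) :=
  Finset.univ.filter fun k => X k ∈ S P i

lemma mem_groupObs {n : ℕ} {X : Fin n → E D} {i : Fin M} {k : Fin n} :
    k ∈ groupObs P X i ↔ X k ∈ S P i := by
  simp [groupObs]

/-- If the observations are `2 ρ`-dense in a connected support, they link it at radius `4 ρ`. -/
lemma mem_cluster_of_dense {n : ℕ} {X : Fin n → E D} {ρ : ℝ} {A : Set (E D)}
    (hA : IsPreconnected A) {C : Finset (E D)} (hC : ∀ x ∈ A, ∃ c ∈ C, dist x c < ρ)
    (hX : ∀ c ∈ C, ∃ k, X k ∈ Metric.ball c ρ) {k l : Fin n} (hk : X k ∈ A) (hl : X l ∈ A) :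
    l ∈ cluster X (4 * ρ) k := by
  rw [mem_cluster]
  refine hA.subset_connectedComponentIn hk (fun x hx => ?_) hl
  obtain ⟨c, hc, hxc⟩ := hC x hx
  obtain ⟨a, ha⟩ := hX c hc
  refine Set.mem_iUnion.2 ⟨a, ?_⟩
  rw [Metric.mem_ball] at ha
  rw [Metric.mem_closedBall]
  have := dist_triangle_right x (X a) c
  linarith

/-- The procedure fails only if some small ball around a point of a support contains no
observation, if there is a long chain of outliers, or if the size of some group is far from its
mean. -/
theorem risk_le (h : IsModel P₀ P γ) (h1 : A1 P) {δ : ℝ}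
    (hδ : ∀ i j, i ≠ j → ∀ x ∈ S P i, ∀ y ∈ S P j, δ ≤ dist x y)
    {κ₀ : ℝ} (h2 : A2 P₀ P κ₀) {κ : Fin M → ℝ} (h3 : A3 P κ)
    {κc : ℝ} (h4 : A4 P κc) {ε : ℝ} (h6 : A6 γ ε) (hγ : 0 < gammaMin γ) {m : ℝ} (hm0 : 0 < m)
    (hm : ∀ s : ℝ, 0 ≤ s → s ≤ D → m ≤ ballVol s) (hd : maxDim P ≤ D)
    {C : ℝ} (hC0 : 0 < C) (hC : ∀ (x : E D) (r : ℝ), 0 ≤ r →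
      hausdorff (D : ℝ) (Metric.closedBall x r) ≤ ENNReal.ofReal (C * r ^ D))
    {n : ℕ} (hn : 0 < n) {ρ : ℝ} (hρ : 0 < ρ) (hρ1 : ρ ≤ 1)
    (hdiam : ∀ i, ρ ≤ Metric.diam (S P i) ∨ Metric.diam (S P i) = 0)
    {K : ℕ} (hK : (K + 1) * (4 * ρ) < δ) :
    risk P (mixture P₀ P γ ε) n ≤ ENNReal.ofReal
      (M * (((Real.sqrt D + 2) / ρ) ^ D *
          Real.exp (-(n * (constA P γ κ κc * m * ρ ^ maxDim P)))) +
        n * (n * (ε * κ₀ * (C * (4 * ρ) ^ D))) ^ K + M * (1 / (slack γ ^ 2 * n))) := by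
  classical
  set Q := mixture P₀ P γ ε with hQ
  have hprob : IsProbabilityMeasure Q := h.isProbabilityMeasure_mixture h6.2.1 h6.lt_one.le
  set p := constA P γ κ κc * m * ρ ^ maxDim P with hp
  set q := ε * κ₀ * (C * (4 * ρ) ^ D) with hq
  set μ := Measure.pi (fun _ : Fin n => Q) with hμ
  have hq0 : 0 ≤ q := by
    have := h6.2.1
    have := h2.1
    positivity
  have hs := h6.slack_pos
  have hn' : (0 : ℝ) < n := by exact_mod_cast hn
  set N := ⌊Real.sqrt D / ρ⌋₊ + 1 with hN
  have hNpos : 0 < N := Nat.succ_pos _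
  have hNlt : Real.sqrt D / N < ρ := by
    rw [div_lt_comm₀ (by exact_mod_cast hNpos) hρ, hN]
    push_cast
    exact Nat.lt_floor_add_one _
  have hNle : ((N : ℝ) + 1) ≤ (Real.sqrt D + 2) / ρ := by
    have e1 : (⌊Real.sqrt D / ρ⌋₊ : ℝ) ≤ Real.sqrt D / ρ := Nat.floor_le (by positivity)
    have e2 : 2 ≤ 2 / ρ := by rw [le_div_iff₀ hρ]; linarith
    rw [add_div, hN]
    push_cast
    linarith
  have hcover : ∀ i, ∃ F : Finset (E D), F.card ≤ (N + 1) ^ D ∧ (∀ c ∈ F, c ∈ S P i) ∧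
      ∀ x ∈ S P i, ∃ c ∈ F, dist x c < ρ := fun i => by
    obtain ⟨F, h1, h2, h3⟩ := exists_finset_cover_of_subset_cube (h.S_subset_cube i) hNpos
    exact ⟨F, h1, h2, fun x hx => (h3 x hx).imp fun c hc => ⟨hc.1, hc.2.trans_lt hNlt⟩⟩
  choose F hFcard hFS hFcov using hcover
  set B₁ : Set (Fin n → E D) := ⋃ i, ⋃ c ∈ F i, {X | ∀ k, X k ∉ Metric.ball c ρ} with hB₁
  set B₂ : Set (Fin n → E D) := {X | ∃ f : Fin (K + 1) → Fin n, Function.Injective f ∧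
    (∀ t, X (f t) ∈ (⋃ i, S P i)ᶜ) ∧
      ∀ t : Fin K, dist (X (f t.succ)) (X (f t.castSucc)) ≤ 4 * ρ} with hB₂
  set B₃ : Set (Fin n → E D) := ⋃ i, {X | slack γ * n ≤
    |((groupObs P X i).card : ℝ) - n * (Q (S P i)).toReal|} with hB₃
  have hsub : {X : Fin n → E D | ∀ π : Equiv.Perm (Fin M), ∃ i : Fin M,
      ¬ ∀ k, X k ∈ S P i → k ∈ largest X (selectedRadius M X) (π i)} ⊆ B₁ ∪ (B₂ ∪ B₃) := by
    intro X hX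
    by_contra hgood
    rw [Set.mem_union, Set.mem_union, not_or, not_or] at hgood
    obtain ⟨hg1, hg2, hg3⟩ := hgood
    have hg1' : ∀ i, ∀ c ∈ F i, ∃ k, X k ∈ Metric.ball c ρ := by
      intro i c hc
      by_contra! hcon
      exact hg1 (Set.mem_iUnion.2 ⟨i, Set.mem_iUnion₂.2 ⟨c, hc, hcon⟩⟩)
    have hg3' : ∀ i, |((groupObs P X i).card : ℝ) - n * ((1 - ε) * γ i)| < slack γ * n := by
      intro i
      by_contra! hcon
      refine hg3 (Set.mem_iUnion.2 ⟨i, ?_⟩)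
      rw [Set.mem_ofPred_eq, hQ, h.mixture_S h1 h6.lt_one.le]
      exact hcon
    have hsum : ∑ i, (1 - ε) * γ i = 1 - ε := by
      rw [← Finset.mul_sum, h.weight_sum, mul_one]
    have hdisj : ∀ i j, i ≠ j → Disjoint (groupObs P X i) (groupObs P X j) := by
      intro i j hij
      rw [Finset.disjoint_left]
      intro k hk hk'
      exact Set.disjoint_left.1 (h1.disjoint hij) (mem_groupObs.1 hk) (mem_groupObs.1 hk')
    obtain ⟨hO, hI⟩ := card_lt_of_abs_sub_lt hdisj hsum hg3'
      (fun i => (h6.add_slack_le i i).1) (fun i j => (h6.add_slack_le i j).2)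
    obtain ⟨π, hπ⟩ := exists_perm_subset_largest (X := X) (I := groupObs P X)
      (O := (Finset.univ.biUnion (groupObs P X))ᶜ) (r := 4 * ρ) (by positivity)
      (fun k => by
        by_cases hk : ∃ i, k ∈ groupObs P X i
        · exact Or.inr hk
        · left
          simpa using hk)
      (fun i k hk l hl => mem_cluster_of_dense (h1.1 i).isPreconnected (hFcov i) (hg1' i)
        (mem_groupObs.1 hk) (mem_groupObs.1 hl))
      (fun i j hij k hk l hl hkl => hg2 (exists_outlier_chain (by positivity) hδ hK hij
        (mem_groupObs.1 hk) (mem_groupObs.1 hl) hkl))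
      hO hI
    obtain ⟨i, hi⟩ := hX π
    exact hi fun k hk => hπ i (mem_groupObs.2 hk)
  have hμ₁ : μ B₁ ≤ ENNReal.ofReal
      (M * (((Real.sqrt D + 2) / ρ) ^ D * Real.exp (-(n * p)))) := by
    calc μ B₁ ≤ ∑ i, ∑ c ∈ F i, μ {X | ∀ k, X k ∉ Metric.ball c ρ} :=
          (measure_iUnion_fintype_le _ _).trans
            (Finset.sum_le_sum fun i _ => measure_biUnion_finset_le _ _)
      _ ≤ ∑ i, ∑ c ∈ F i, ENNReal.ofReal (Real.exp (-(n * p))) := by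
          refine Finset.sum_le_sum fun i _ => Finset.sum_le_sum fun c hc => ?_
          exact pi_forall_notMem_le Q measurableSet_ball
            (le_mixture_ball h h3 h4 h6 hγ hm0 hm hd i (hFS i c hc) hρ hρ1 (hdiam i)) n
      _ ≤ ∑ _i : Fin M, ENNReal.ofReal
            (((Real.sqrt D + 2) / ρ) ^ D * Real.exp (-(n * p))) := by
          refine Finset.sum_le_sum fun i _ => ?_
          rw [Finset.sum_const, nsmul_eq_mul, ← ENNReal.ofReal_natCast,
            ← ENNReal.ofReal_mul (Nat.cast_nonneg _)]
          refine ENNReal.ofReal_le_ofReal ?_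
          gcongr
          calc ((F i).card : ℝ) ≤ ((N : ℝ) + 1) ^ D := by exact_mod_cast hFcard i
            _ ≤ _ := by gcongr
      _ = _ := by
          rw [Finset.sum_const, nsmul_eq_mul, Finset.card_univ, Fintype.card_fin,
            ← ENNReal.ofReal_natCast, ← ENNReal.ofReal_mul (Nat.cast_nonneg _)]
  have hμ₂ : μ B₂ ≤ ENNReal.ofReal (n * (n * q) ^ K) := by
    have hOm : MeasurableSet (⋃ i, S P i)ᶜ :=
      (MeasurableSet.iUnion fun i => (isClosed_S i).measurableSet).compl
    refine (pi_exists_chain_le Q hOm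
      (h.mixture_outlier_closedBall_le h2 h6.2.1 hC (by positivity)) n K).trans_eq ?_
    rw [ENNReal.ofReal_mul hn'.le, ENNReal.ofReal_pow (by positivity), ENNReal.ofReal_mul hn'.le,
      ENNReal.ofReal_natCast]
  have hμ₃ : μ B₃ ≤ ENNReal.ofReal (M * (1 / (slack γ ^ 2 * n))) := by
    calc μ B₃ ≤ ∑ i, μ {X | slack γ * n ≤
          |((groupObs P X i).card : ℝ) - n * (Q (S P i)).toReal|} :=
          measure_iUnion_fintype_le _ _
      _ ≤ ∑ _i : Fin M, ENNReal.ofReal (1 / (slack γ ^ 2 * n)) := by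
          refine Finset.sum_le_sum fun i _ => ?_
          have := pi_abs_count_sub_ge_le Q (isClosed_S (P := P) i).measurableSet (n := n) hs hn
          exact this
      _ = _ := by
          rw [Finset.sum_const, nsmul_eq_mul, Finset.card_univ, Fintype.card_fin,
            ← ENNReal.ofReal_natCast, ← ENNReal.ofReal_mul (Nat.cast_nonneg _)]
  calc risk P Q n ≤ μ (B₁ ∪ (B₂ ∪ B₃)) := measure_mono hsub
    _ ≤ μ B₁ + (μ B₂ + μ B₃) :=
      (measure_union_le _ _).trans (add_le_add_right (measure_union_le _ _) _)
    _ ≤ _ := add_le_add hμ₁ (add_le_add hμ₂ hμ₃)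
    _ = _ := by
      rw [← ENNReal.ofReal_add (by positivity) (by positivity),
        ← ENNReal.ofReal_add (by positivity) (by positivity), add_assoc]

end FiniteSample

/-! ### Consistency -/

section Consistency

variable {D M : ℕ} {P₀ : Measure (E D)} {P : Fin M → Measure (E D)} {γ : Fin M → ℝ}

lemma IsModel.pos (h : IsModel P₀ P γ) : 0 < M := by
  rcases Nat.eq_zero_or_pos M with rfl | hM
  · have := h.weight_sum
    simp at this
  · exact hM

/-- In dimension `0` the supports leave no room for outliers. -/
lemma IsModel.dim_ne_zero (h : IsModel P₀ P γ) (h1 : A1 P) : D ≠ 0 := by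
  rintro rfl
  have := h.prob_outlier
  obtain ⟨x, hx⟩ := Measure.nonempty_support (IsProbabilityMeasure.ne_zero P₀)
  obtain ⟨y, hy⟩ := closure_nonempty_iff.1 ⟨x, h.support_outlier hx⟩
  obtain ⟨z, hz⟩ := (h1.1 ⟨0, h.pos⟩).nonempty
  exact hy.2 (Set.mem_iUnion.2 ⟨_, Subsingleton.elim z y ▸ hz⟩)

lemma A6.gammaMin_pos {ε : ℝ} (h : A6 γ ε) (hM : 0 < M) : 0 < gammaMin γ := by
  have h1 := gammaMin_le γ ⟨0, hM⟩
  have h2 := le_gammaMax γ ⟨0, hM⟩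
  have := h.1
  linarith

lemma constA_pos {ε : ℝ} (h6 : A6 γ ε) (hM : 0 < M) {κ : Fin M → ℝ} (h3 : A3 P κ) {κc : ℝ}
    (h4 : A4 P κc) : 0 < constA P γ κ κc := by
  have hγ := h6.gammaMin_pos hM
  have hb := h6.gammaBar_pos
  have hc := h4.1
  have hκ : 0 < ⨆ i, κ i :=
    (h3 ⟨0, hM⟩).1.trans_le (le_ciSup (Set.finite_range κ).bddAbove _)
  have hη := ballVol_pos ((sdim_nonneg P ⟨0, hM⟩).trans (sdim_le_maxDim P _))
  have hmin : 0 < min 1 (ballVol (maxDim P)) := lt_min one_pos hη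
  unfold constA
  positivity

/-- The procedure is consistent if there is a scale `ρ = o(1 / log n)` that is large enough for the
observations to link each support, and small enough for an outlier to have fewer than `e⁻¹` others
within reach on average. Chains of outliers are then of logarithmic length, too short to connect two
supports. -/
theorem tendsto_risk_of_scale (h : IsModel P₀ P γ) (h1 : A1 P)
    {κ₀ : ℝ} (h2 : A2 P₀ P κ₀) {κ : Fin M → ℝ} (h3 : A3 P κ)
    {κc : ℝ} (h4 : A4 P κc) {ε : ℕ → ℝ} (h6 : ∀ n, A6 γ (ε n)) {m : ℝ} (hm0 : 0 < m)
    (hm : ∀ s : ℝ, 0 ≤ s → s ≤ D → m ≤ ballVol s) (hd : maxDim P ≤ D)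
    {C : ℝ} (hC0 : 0 < C) (hC : ∀ (x : E D) (r : ℝ), 0 ≤ r →
      hausdorff (D : ℝ) (Metric.closedBall x r) ≤ ENNReal.ofReal (C * r ^ D))
    {ρ : ℕ → ℝ} (hρ : ∀ᶠ n in atTop, 0 < ρ n)
    (hlog : Tendsto (fun n : ℕ => ρ n * Real.log n) atTop (𝓝 0))
    (hfill : Tendsto (fun n : ℕ => (1 / ρ n) ^ D *
      Real.exp (-(n * (constA P γ κ κc * m * ρ n ^ maxDim P)))) atTop (𝓝 0))
    (hchain : ∀ᶠ n : ℕ in atTop, n * (ε n * κ₀ * (C * (4 * ρ n) ^ D)) ≤ Real.exp (-1)) :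
    Tendsto (fun n : ℕ => risk P (mixture P₀ P γ (ε n)) n) atTop (𝓝 0) := by
  have hγ := (h6 0).gammaMin_pos h.pos
  obtain ⟨δ, hδ0, hδ⟩ := h1.2
  have hlogn : ∀ᶠ n : ℕ in atTop, 1 ≤ Real.log n :=
    (Real.tendsto_log_atTop.comp tendsto_natCast_atTop_atTop).eventually_ge_atTop 1
  have hρ0 : Tendsto ρ atTop (𝓝 0) := by
    refine tendsto_of_tendsto_of_tendsto_of_le_of_le' tendsto_const_nhds hlog
      (hρ.mono fun n hn => hn.le) ?_
    filter_upwards [hρ, hlogn] with n h1 h2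
    nlinarith
  have hsmall : ∀ a : ℝ, 0 < a → ∀ᶠ n in atTop, ρ n ≤ a := fun a ha =>
    (hρ0.eventually_lt_const ha).mono fun n hn => hn.le
  have hdiam : ∀ᶠ n in atTop, ∀ i, ρ n ≤ Metric.diam (S P i) ∨ Metric.diam (S P i) = 0 := by
    refine eventually_all.2 fun i => ?_
    rcases (Metric.diam_nonneg (s := S P i)).eq_or_lt with h0 | h0
    · exact Eventually.of_forall fun n => Or.inr h0.symm
    · exact (hsmall _ h0).mono fun n hn => Or.inl hn
  have hKδ : ∀ᶠ n : ℕ in atTop, ((⌈2 * Real.log n⌉₊ : ℝ) + 1) * (4 * ρ n) < δ := by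
    have : Tendsto (fun n : ℕ => 8 * (ρ n * Real.log n) + 8 * ρ n) atTop (𝓝 (8 * 0 + 8 * 0)) :=
      (hlog.const_mul 8).add (hρ0.const_mul 8)
    filter_upwards [this.eventually_lt_const (u := δ) (by simpa using hδ0), hρ, hlogn]
      with n hn hρn hl
    have := (Nat.ceil_lt_add_one (by linarith : 0 ≤ 2 * Real.log n)).le
    nlinarith
  -- a factor `e⁻¹` for each of at least `2 log n` steps outweighs the `n` starting points
  have hchain' : ∀ᶠ n : ℕ in atTop,
      n * (n * (ε n * κ₀ * (C * (4 * ρ n) ^ D))) ^ ⌈2 * Real.log n⌉₊ ≤ 1 / n := by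
    filter_upwards [hchain, hρ, eventually_gt_atTop 0] with n hq hρn hn
    have hn' : (0 : ℝ) < n := by exact_mod_cast hn
    have hq0 : 0 ≤ n * (ε n * κ₀ * (C * (4 * ρ n) ^ D)) := by
      have := (h6 n).2.1
      have := h2.1
      positivity
    have hexp : Real.exp (-1) ^ ⌈2 * Real.log n⌉₊ ≤ 1 / n ^ 2 := by
      rw [← Real.exp_nat_mul, one_div, ← Real.exp_log (by positivity : (0 : ℝ) < n ^ 2),
        ← Real.exp_neg, Real.exp_le_exp, Real.log_pow]
      have := Nat.le_ceil (2 * Real.log n)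
      push_cast
      linarith
    calc _ ≤ n * (Real.exp (-1) ^ ⌈2 * Real.log n⌉₊) := by gcongr
      _ ≤ n * (1 / n ^ 2) := by gcongr
      _ = 1 / n := by field_simp
  have hn1 : Tendsto (fun n : ℕ => 1 / (n : ℝ)) atTop (𝓝 0) := tendsto_one_div_atTop_nhds_zero_nat
  have hbound : Tendsto (fun n : ℕ => M * (Real.sqrt D + 2) ^ D * ((1 / ρ n) ^ D *
      Real.exp (-(n * (constA P γ κ κc * m * ρ n ^ maxDim P)))) + 1 / n +
        M / slack γ ^ 2 * (1 / n)) atTop (𝓝 0) := by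
    simpa using ((hfill.const_mul _).add hn1).add (hn1.const_mul (M / slack γ ^ 2))
  have hbound' := ENNReal.tendsto_ofReal hbound
  rw [ENNReal.ofReal_zero] at hbound'
  refine tendsto_of_tendsto_of_tendsto_of_le_of_le' tendsto_const_nhds hbound'
    (Eventually.of_forall fun _ => zero_le) ?_
  filter_upwards [hρ, hsmall 1 one_pos, hdiam, hKδ, hchain', eventually_gt_atTop 0]
    with n hρn hρ1 hdn hK hch hn
  refine (risk_le h h1 hδ h2 h3 h4 (h6 n) hγ hm0 hm hd hC0 hC hn hρn hρ1 hdn hK).trans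
    (ENNReal.ofReal_le_ofReal ?_)
  have e1 : (M : ℝ) * (((Real.sqrt D + 2) / ρ n) ^ D *
      Real.exp (-(n * (constA P γ κ κc * m * ρ n ^ maxDim P)))) =
      M * (Real.sqrt D + 2) ^ D * ((1 / ρ n) ^ D *
        Real.exp (-(n * (constA P γ κ κc * m * ρ n ^ maxDim P)))) := by
    rw [div_eq_mul_one_div, mul_pow]
    ring
  have e2 : (M : ℝ) * (1 / (slack γ ^ 2 * n)) = M / slack γ ^ 2 * (1 / n) := by
    field_simp
  rw [e1, e2]
  gcongr

/-- For `d < D` the scale `n ^ (-β)` with `β d < 1 < β D` has both properties. -/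
theorem tendsto_risk_of_maxDim_lt (h : IsModel P₀ P γ) (h1 : A1 P)
    {κ₀ : ℝ} (h2 : A2 P₀ P κ₀) {κ : Fin M → ℝ} (h3 : A3 P κ)
    {κc : ℝ} (h4 : A4 P κc) {ε : ℕ → ℝ} (h6 : ∀ n, A6 γ (ε n)) (hd : maxDim P < D) :
    Tendsto (fun n : ℕ => risk P (mixture P₀ P γ (ε n)) n) atTop (𝓝 0) := by
  obtain ⟨m, hm0, hm⟩ := exists_pos_le_ballVol D
  obtain ⟨C, hC0, hC⟩ := exists_hausdorff_closedBall_le D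
  have hd0 : 0 ≤ maxDim P := (sdim_nonneg P ⟨0, h.pos⟩).trans (sdim_le_maxDim P _)
  have hA := constA_pos (h6 0) h.pos h3 h4
  set a := constA P γ κ κc * m with ha
  have ha0 : 0 < a := mul_pos hA hm0
  set d := maxDim P
  set β : ℝ := 2 / (d + D) with hβ
  have hβ0 : 0 < β := by
    have : 0 < d + D := by linarith
    positivity
  have hβd : 0 < 1 - β * d := by
    rw [hβ, div_mul_eq_mul_div, sub_pos, div_lt_one (by linarith)]
    linarith
  have hβD : 0 < β * D - 1 := by
    rw [hβ, div_mul_eq_mul_div, sub_pos, one_lt_div (by linarith)]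
    linarith
  have hpos : ∀ᶠ n : ℕ in atTop, (0 : ℝ) < n :=
    (eventually_gt_atTop 0).mono fun n hn => by exact_mod_cast hn
  refine tendsto_risk_of_scale h h1 h2 h3 h4 h6 hm0 hm hd.le hC0 hC
    (ρ := fun n => (n : ℝ) ^ (-β)) ?_ ?_ ?_ ?_
  · exact hpos.mono fun n hn => Real.rpow_pos_of_pos hn _
  · have := ((isLittleO_log_rpow_atTop hβ0).tendsto_div_nhds_zero).comp
      (tendsto_natCast_atTop_atTop (R := ℝ))
    refine this.congr' (hpos.mono fun n hn => ?_)
    simp only [Function.comp]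
    rw [Real.rpow_neg hn.le]
    ring
  · have h1 := (tendsto_rpow_mul_exp_neg_mul_atTop_nhds_zero (β * D / (1 - β * d)) a ha0).comp
      ((tendsto_rpow_atTop hβd).comp (tendsto_natCast_atTop_atTop (R := ℝ)))
    refine h1.congr' (hpos.mono fun n hn => ?_)
    simp only [Function.comp]
    rw [← Real.rpow_mul hn.le, mul_div_cancel₀ _ hβd.ne', Real.rpow_neg hn.le, one_div, inv_inv,
      ← Real.rpow_natCast, ← Real.rpow_mul hn.le, ← Real.rpow_neg hn.le, ← Real.rpow_mul hn.le]
    congr 2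
    rw [sub_eq_add_neg, Real.rpow_add hn, Real.rpow_one]
    change _ = -(n * (a * (n : ℝ) ^ (-β * d)))
    ring_nf
  · have h1 : Tendsto (fun n : ℕ => κ₀ * C * 4 ^ D * (n : ℝ) ^ (-(β * D - 1))) atTop (𝓝 0) := by
      simpa using ((tendsto_rpow_neg_atTop hβD).comp
        (tendsto_natCast_atTop_atTop (R := ℝ))).const_mul (κ₀ * C * 4 ^ D)
    filter_upwards [h1.eventually_lt_const (Real.exp_pos (-1)), hpos] with n hn hn0
    refine le_trans ?_ hn.le
    have e1 : ((n : ℝ) ^ (-β)) ^ D * n = (n : ℝ) ^ (-(β * D - 1)) := by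
      rw [← Real.rpow_natCast, ← Real.rpow_mul hn0.le]
      nth_rewrite 2 [← Real.rpow_one (n : ℝ)]
      rw [← Real.rpow_add hn0]
      ring_nf
    rw [← e1, mul_pow]
    have hε := (h6 n).lt_one.le
    have := h2.1
    calc _ = ε n * (κ₀ * C * 4 ^ D * (((n : ℝ) ^ (-β)) ^ D * n)) := by ring
      _ ≤ 1 * (κ₀ * C * 4 ^ D * (((n : ℝ) ^ (-β)) ^ D * n)) := by gcongr
      _ = _ := one_mul _

/-- For `d = D` the scale at which a ball around a point of a support contains `log n` observations
on average links the supports, and the bound on `ε` keeps the outliers apart. -/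
theorem tendsto_risk_of_maxDim_eq (h : IsModel P₀ P γ) (h1 : A1 P)
    {κ₀ : ℝ} (h2 : A2 P₀ P κ₀) {κ : Fin M → ℝ} (h3 : A3 P κ)
    {κc : ℝ} (h4 : A4 P κc) {ε : ℕ → ℝ} (h6 : ∀ n, A6 γ (ε n)) (hd : maxDim P = D) {m : ℝ}
    (hm0 : 0 < m) (hm : ∀ s : ℝ, 0 ≤ s → s ≤ D → m ≤ ballVol s)
    {C : ℝ} (hC0 : 0 < C) (hC : ∀ (x : E D) (r : ℝ), 0 ≤ r →
      hausdorff (D : ℝ) (Metric.closedBall x r) ≤ ENNReal.ofReal (C * r ^ D))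
    (hε : ∀ᶠ n : ℕ in atTop, ε n < Real.exp (-1) * ballVol D * m / (4 ^ D * C) *
      constA P γ κ κc * (constB D κ₀ * Real.log n)⁻¹) :
    Tendsto (fun n : ℕ => risk P (mixture P₀ P γ (ε n)) n) atTop (𝓝 0) := by
  have hA := constA_pos (h6 0) h.pos h3 h4
  set a := constA P γ κ κc * m with ha
  have ha0 : 0 < a := mul_pos hA hm0
  have hD : D ≠ 0 := h.dim_ne_zero h1
  have hD0 : (0 : ℝ) < D := by exact_mod_cast Nat.pos_of_ne_zero hD
  have hη := ballVol_pos hD0.le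
  have hκ₀ := h2.1
  have hlogt : Tendsto (fun n : ℕ => Real.log n) atTop atTop :=
    Real.tendsto_log_atTop.comp tendsto_natCast_atTop_atTop
  have hlogn : ∀ᶠ n : ℕ in atTop, 0 < Real.log n := hlogt.eventually_gt_atTop 0
  have hpos : ∀ᶠ n : ℕ in atTop, (0 : ℝ) < n :=
    (eventually_gt_atTop 0).mono fun n hn => by exact_mod_cast hn
  have hpow : ∀ᶠ n : ℕ in atTop, ((Real.log n / (a * n)) ^ (1 / (D : ℝ))) ^ D =
      Real.log n / (a * n) := by
    filter_upwards [hlogn, hpos] with n hl hn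
    rw [one_div]
    exact Real.rpow_inv_natCast_pow (by positivity) hD
  refine tendsto_risk_of_scale h h1 h2 h3 h4 h6 hm0 hm hd.le hC0 hC
    (ρ := fun n => (Real.log n / (a * n)) ^ (1 / (D : ℝ))) ?_ ?_ ?_ ?_
  · filter_upwards [hlogn, hpos] with n hl hn
    positivity
  · have h0 : Tendsto (fun n : ℕ => Real.log n ^ ((D : ℝ) + 1) / (n : ℝ) ^ (1 : ℝ)) atTop (𝓝 0) :=
      ((isLittleO_log_rpow_rpow_atTop ((D : ℝ) + 1) one_pos).tendsto_div_nhds_zero).comp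
        (tendsto_natCast_atTop_atTop (R := ℝ))
    have h1 := (h0.const_mul (1 / a)).rpow_const (p := 1 / (D : ℝ)) (Or.inr (by positivity))
    rw [mul_zero, Real.zero_rpow (by positivity)] at h1
    refine h1.congr' ?_
    filter_upwards [hlogn, hpos] with n hl hn
    have e1 : 1 / a * (Real.log n ^ ((D : ℝ) + 1) / (n : ℝ) ^ (1 : ℝ)) =
        Real.log n / (a * n) * Real.log n ^ (D : ℝ) := by
      rw [Real.rpow_add hl, Real.rpow_one, Real.rpow_one]
      field_simp
    rw [e1, Real.mul_rpow (by positivity) (by positivity), ← Real.rpow_mul hl.le,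
      mul_one_div_cancel hD0.ne', Real.rpow_one]
  · have h1 : Tendsto (fun n : ℕ => a * (Real.log n)⁻¹) atTop (𝓝 0) := by
      simpa using (tendsto_inv_atTop_zero.comp hlogt).const_mul a
    refine h1.congr' ?_
    filter_upwards [hlogn, hpos, hpow] with n hl hn hp
    rw [hd, Real.rpow_natCast, one_div_pow, hp]
    have e1 : (n : ℝ) * (a * (Real.log n / (a * n))) = Real.log n := by field_simp
    rw [e1, Real.exp_neg, Real.exp_log hn]
    field_simp
  · filter_upwards [hlogn, hpos, hpow, hε] with n hl hn hp he
    rw [mul_pow, hp]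
    have hb : 0 < constB D κ₀ := mul_pos hη hκ₀
    calc _ = ε n * (κ₀ * C * 4 ^ D * Real.log n / a) := by field_simp
      _ ≤ (Real.exp (-1) * ballVol D * m / (4 ^ D * C) *
          constA P γ κ κc * (constB D κ₀ * Real.log n)⁻¹) *
            (κ₀ * C * 4 ^ D * Real.log n / a) := by gcongr
      _ = Real.exp (-1) := by
        rw [ha]
        unfold constB
        field_simp

end Consistency

end OSL

theorem mainTheorem4 (D : ℕ) :
    ∃ c : ℝ, 0 < c ∧
      ∀ (M : ℕ) (P₀ : Measure (OSL.E D)) (P : Fin M → Measure (OSL.E D)) (γ : Fin M → ℝ)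
        (κ₀ : ℝ) (κ : Fin M → ℝ) (κc : ℝ) (ε : ℕ → ℝ),
        OSL.IsModel P₀ P γ →
        OSL.A1 P → OSL.A2 P₀ P κ₀ → OSL.A3 P κ → OSL.A4 P κc → OSL.A5 P →
        (∀ n, OSL.A6 γ (ε n)) →
        (OSL.maxDim P < D ∨
          (OSL.maxDim P = D ∧
            ∀ᶠ n : ℕ in atTop,
              ε n < c * OSL.constA P γ κ κc * (OSL.constB D κ₀ * Real.log n)⁻¹)) →
        Tendsto (fun n : ℕ => OSL.risk P (OSL.mixture P₀ P γ (ε n)) n) atTop (𝓝 0) := by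
  obtain ⟨m, hm0, hm⟩ := OSL.exists_pos_le_ballVol D
  obtain ⟨C, hC0, hC⟩ := OSL.exists_hausdorff_closedBall_le D
  have hη := OSL.ballVol_pos (Nat.cast_nonneg (α := ℝ) D)
  refine ⟨Real.exp (-1) * OSL.ballVol D * m / (4 ^ D * C), by positivity, ?_⟩
  intro M P₀ P γ κ₀ κ κc ε h h1 h2 h3 h4 _ h6 hcase
  rcases hcase with hd | ⟨hd, hε⟩
  · exact OSL.tendsto_risk_of_maxDim_lt h h1 h2 h3 h4 h6 hd
  · exact OSL.tendsto_risk_of_maxDim_eq h h1 h2 h3 h4 h6 hd hm0 hm hC0 hC hε
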